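/- Let $(w_k)_{k\ge 0}$ be a sequence of non-negative real numbers with $w_0>0$ and $w_k>0$ for some $k\ge 1$. For integers $m\ge 0$, $n\ge 1$, let $Z(m,n)=\sum \prod_{i=1}^n w_{y_i}$, the sum being over all $(y_1,\dots,y_n)\in\{0,1,2,\dots\}^n$ with $y_1+\dots+y_n=m$. If $Z(m,n)>0$, let $(Y_1,\dots,Y_n)$ be the random allocation of $m$ balls in $n$ boxes that equals each such $(y_1,\dots,y_n)$ with probability $\prod_{i=1}^n w_{y_i}/Z(m,n)$, and let $Y_{(1)}\ge Y_{(2)}\ge\dots\ge Y_{(n)}$ be $Y_1,\dots,Y_n$ arranged in decreasing order. Let $\Phi(t)=\sum_{k\ge0} w_k t^k$, let $\rho\in[0,\infty]$ be its radius of convergence, let $\Psi(t)=t\Phi'(t)/\Phi(t)=\sum_k k w_kt^k/\sum_k w_kt^k$ for those $t\in[0,\rho]$ with $\Phi(t)<\infty$, let $\Psi(\rho)=\lim_{t\uparrow\rho}\Psi(t)$ if $\Phi(\rho)=\infty$, and let $\nu=\Psi(\rho)\in[0,\infty]$. Suppose that $n\to\infty$ (along a sequence of integers) and that $m=m(n)$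 satisfies $Z(m,n)>0$ and $m/n\to\lambda$, where $0<\lambda<\nu$. Then there is a unique $\tau\in[0,\rho]$ with $\Psi(\tau)=\lambda$; it satisfies $0<\tau<\rho$; and, with $1/\log(\rho/\tau)$ read as $0$ if $\rho=\infty$, the following hold. (i) $Y_{(1)}\le \frac{1}{\log(\rho/\tau)}\log n+o_p(\log n)$, where $o_p(\log n)$ denotes random variables $X_n$ with $X_n/\log n\to0$ in probability. (ii) In particular, if $\rho=\infty$, then $Y_{(1)}=o_p(\log n)$. (iii) If, moreover, $w_k^{1/k}\to 1/\rho$ as $k\to\infty$, then for every fixed $j\ge1$, $\frac{Y_{(j)}}{\log n}\to\frac1{\log(\rho/\tau)}$ in probability. -/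

import Mathlib

open scoped NNReal ENNReal Topology

noncomputable section

namespace BallsInBoxes

/-- The generating function `Φ(t) = ∑ w_k t^k` of the weight sequence `w`, for `t ∈ [0,∞]`. -/
def genFun (w : ℕ → ℝ≥0) (t : ℝ≥0∞) : ℝ≥0∞ := ∑' k : ℕ, (w k : ℝ≥0∞) * t ^ k

/-- The radius of convergence `ρ ∈ [0,∞]` of the power series `∑ w_k z^k`. -/
def rho (w : ℕ → ℝ≥0) : ℝ≥0∞ :=
  (FormalMultilinearSeries.ofScalars ℝ (fun k => (w k : ℝ))).radius

/-- The quotient `t Φ'(t) / Φ(t) = (∑ k w_k t^k) / (∑ w_k t^k)`. -/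
def psiQuot (w : ℕ → ℝ≥0) (t : ℝ≥0∞) : ℝ≥0∞ :=
  (∑' k : ℕ, (k : ℝ≥0∞) * (w k : ℝ≥0∞) * t ^ k) / genFun w t

open Classical in
/-- The function `Ψ` on `[0,ρ]`: it is `t Φ'(t) / Φ(t)` where `Φ(t) < ∞`, and otherwise (on `[0,ρ]`
this can only happen at `t = ρ`) it is the limit of `s Φ'(s) / Φ(s)` as `s ↑ t`. -/
def Psi (w : ℕ → ℝ≥0) (t : ℝ≥0∞) : ℝ≥0∞ :=
  if genFun w t < ⊤ then psiQuot w t else Filter.limUnder (𝓝[<] t) (psiQuot w)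

/-- `ν = Ψ(ρ)`. -/
def nu (w : ℕ → ℝ≥0) : ℝ≥0∞ := Psi w (rho w)

/-- The weight `w(y) = ∏ w_{y_i}` of an allocation `y = (y_1, …, y_n)`. -/
def weight (w : ℕ → ℝ≥0) {n : ℕ} (y : Fin n → ℕ) : ℝ≥0 := ∏ i, w (y i)

/-- The finite set of allocations of `m` balls in `n` boxes: all `y ∈ ℕ^n` with `∑ y_i = m`. -/
def allocations (m n : ℕ) : Finset (Fin n → ℕ) := Finset.piAntidiag Finset.univ m

theorem mem_allocations {m n : ℕ} {y : Fin n → ℕ} : y ∈ allocations m n ↔ ∑ i, y i = m := by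
  simp [allocations]

/-- The partition function `Z(m,n)`. -/
def partitionFun (w : ℕ → ℝ≥0) (m n : ℕ) : ℝ≥0 := ∑ y ∈ allocations m n, weight w y

/-- The law of the random allocation of `m` balls in `n` boxes: each allocation `y` has probability
`w(y) / Z(m,n)`. It is meaningful only if `Z(m,n) > 0`. -/
def allocLaw (w : ℕ → ℝ≥0) (m n : ℕ) : MeasureTheory.Measure (Fin n → ℕ) :=
  ∑ y ∈ allocations m n,
    ((weight w y / partitionFun w m n : ℝ≥0) : ℝ≥0∞) • MeasureTheory.Measure.dirac y

theorem isProbabilityMeasure_allocLaw (w : ℕ → ℝ≥0) (m n : ℕ) (h : 0 < partitionFun w m n) :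
    MeasureTheory.IsProbabilityMeasure (allocLaw w m n) := by
  constructor
  simp only [allocLaw, MeasureTheory.Measure.coe_finsetSum, Finset.sum_apply,
    MeasureTheory.Measure.smul_apply, MeasureTheory.measure_univ, smul_eq_mul, mul_one]
  rw [← ENNReal.ofNNReal_finsetSum, ← Finset.sum_div]
  change ((partitionFun w m n / partitionFun w m n : ℝ≥0) : ℝ≥0∞) = 1
  rw [div_self h.ne', ENNReal.coe_one]

/-- `nthLargest y j` is the `j`-th largest (`j = 1, …, n`) of the numbers `y_1, …, y_n`, i.e. the
`j`-th entry when they are arranged in decreasing order (it is `0` by convention if `j > n`). -/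
def nthLargest {n : ℕ} (y : Fin n → ℕ) (j : ℕ) : ℕ :=
  ((Finset.univ.val.map y).sort (· ≥ ·)).getD (j - 1) 0

/-- Convergence in probability to a constant `c` of real random variables `X_i`, where `X_i` is
defined on its own probability space `(Ω_i, P_i)`. -/
def TendstoInProb {Ω : ℕ → Type*} [∀ i, MeasurableSpace (Ω i)]
    (P : ∀ i, MeasureTheory.Measure (Ω i)) (X : ∀ i, Ω i → ℝ) (c : ℝ) : Prop :=
  ∀ ε : ℝ, 0 < ε →
    Filter.Tendsto (fun i => P i {x | ε ≤ |X i x - c|}) Filter.atTop (𝓝 0)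

/-- `X_i = o_p(a_i)`, i.e. `X_i / a_i → 0` in probability. -/
def IsLittleOp {Ω : ℕ → Type*} [∀ i, MeasurableSpace (Ω i)]
    (P : ∀ i, MeasureTheory.Measure (Ω i)) (X : ∀ i, Ω i → ℝ) (a : ℕ → ℝ) : Prop :=
  TendstoInProb P (fun i x => X i x / a i) 0

open Classical in
/-- The constant `1 / log(ρ/τ)` for `0 < τ < ρ ≤ ∞`, read as `0` if `ρ = ∞`. -/
def invLogRatio (ρ τ : ℝ≥0∞) : ℝ :=
  if ρ = ⊤ then 0 else 1 / Real.log (ρ.toReal / τ.toReal)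

end BallsInBoxes

end

open Filter MeasureTheory

namespace BallsInBoxes

variable {w : ℕ → ℝ≥0}

/-! ### The power series at real points -/


/-! Replacing `w k` by `w k * t ^ k / Φ(t)` with `0 < t < ρ` multiplies the weight of every
allocation of `m` balls in `n` boxes by the same factor. The random allocation is therefore a vector
of `n` independent variables with the tilted law, conditioned on their sum being `m`. Since `Ψ` is
continuous and strictly increasing on `[0,ρ)` and `λ < ν`, the equation `Ψ(T_i) = m_i / n_i` is
solvable for large `i`, and `T_i → τ`; the tilted variables then have mean exactly `m_i / n_i`.

The conditioning costs only a constant factor. By Fourier inversion and a Gaussian bound on the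
characteristic function, uniform in the tilt, the local limit theorem `tendsto_sqrt_mul_sum` shows
that the sum equals `m` with probability of exact order `n^(-1/2)`. By the same means
`sum_restricted_le` bounds the probability that the sum is `m` and the boxes of a set `B`, at most
half of all, have contents in `A`, by `O(n^(-1/2))` times the independent probability of the latter
event. The powers of `n` cancel in `exists_allocLaw_le`.

What remains is a computation with independent variables. The tilted tail beyond `b log n` is
`O(n^(-γ))` with `γ > 1` when `b > 1 / log(ρ/τ)`, so a union bound over boxes gives the upper
estimate (`tendsto_measure_le_first`). If `w_k^(1/k) → 1/ρ` and `0 < b < 1 / log(ρ/τ)`, a single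
value just above `b log n` has probability at least of order `n^(-γ)` with `γ < 1`. Each of `j`
disjoint blocks of about `n/(2j)` boxes then contains a box with that value with high probability
(`tendsto_measure_nthLargest_le`). -/

theorem summable_pow_mul_weight {r : ℝ} (hr : 0 ≤ r) (hρ : ENNReal.ofReal r < rho w) (j : ℕ) :
    Summable fun k : ℕ => (k : ℝ) ^ j * ((w k : ℝ) * r ^ k) := by
  obtain ⟨R, hrR, hRρ⟩ := ENNReal.lt_iff_exists_nnreal_btwn.1 hρ
  have hrR' : r < R := by
    rw [ENNReal.ofReal, ENNReal.coe_lt_coe] at hrR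
    exact (Real.toNNReal_lt_iff_lt_coe hr).1 hrR
  have hR0 : (0 : ℝ) < R := hr.trans_lt hrR'
  have hs : Summable fun k : ℕ => (w k : ℝ) * (R : ℝ) ^ k := by
    have := FormalMultilinearSeries.summable_norm_mul_pow _ hRρ
    simpa [FormalMultilinearSeries.ofScalars_norm] using this
  have hq : ‖r / R‖ < 1 := by
    rw [Real.norm_of_nonneg (by positivity), div_lt_one hR0]; exact hrR'
  have hg := summable_pow_mul_geometric_of_norm_lt_one j hq
  obtain ⟨M, hM⟩ := hs.tendsto_atTop_zero.bddAbove_range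
  refine Summable.of_nonneg_of_le (fun k => by positivity) (fun k => ?_) (hg.mul_left M)
  have h1 : (w k : ℝ) * (R : ℝ) ^ k ≤ M := hM ⟨k, rfl⟩
  calc (k : ℝ) ^ j * ((w k : ℝ) * r ^ k)
      = ((w k : ℝ) * (R : ℝ) ^ k) * ((k : ℝ) ^ j * (r / R) ^ k) := by
        rw [div_pow]; field_simp
    _ ≤ M * ((k : ℝ) ^ j * (r / R) ^ k) := by gcongr

theorem summable_weight {r : ℝ} (hr : 0 ≤ r) (hρ : ENNReal.ofReal r < rho w) :
    Summable fun k : ℕ => (w k : ℝ) * r ^ k := by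
  simpa using summable_pow_mul_weight hr hρ 0

theorem summable_mul_weight {r : ℝ} (hr : 0 ≤ r) (hρ : ENNReal.ofReal r < rho w) :
    Summable fun k : ℕ => (k : ℝ) * ((w k : ℝ) * r ^ k) := by
  simpa using summable_pow_mul_weight hr hρ 1

/-- `Φ(r)` for real `r`. -/
noncomputable def realGen (w : ℕ → ℝ≥0) (r : ℝ) : ℝ := ∑' k : ℕ, (w k : ℝ) * r ^ k

/-- `r Φ'(r)` for real `r`. -/
noncomputable def realNum (w : ℕ → ℝ≥0) (r : ℝ) : ℝ := ∑' k : ℕ, (k : ℝ) * ((w k : ℝ) * r ^ k)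

/-- `Ψ(r)` for real `r`. -/
noncomputable def realPsi (w : ℕ → ℝ≥0) (r : ℝ) : ℝ := realNum w r / realGen w r

theorem hasSum_realGen {r : ℝ} (hr : 0 ≤ r) (hρ : ENNReal.ofReal r < rho w) :
    HasSum (fun k : ℕ => (w k : ℝ) * r ^ k) (realGen w r) := (summable_weight hr hρ).hasSum

theorem hasSum_realNum {r : ℝ} (hr : 0 ≤ r) (hρ : ENNReal.ofReal r < rho w) :
    HasSum (fun k : ℕ => (k : ℝ) * ((w k : ℝ) * r ^ k)) (realNum w r) :=
  (summable_mul_weight hr hρ).hasSum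

theorem le_realGen {r : ℝ} (hr : 0 ≤ r) (hρ : ENNReal.ofReal r < rho w) : (w 0 : ℝ) ≤ realGen w r := by
  have := (summable_weight hr hρ).le_tsum 0 (fun k _ => by positivity)
  simpa [realGen] using this

theorem realGen_pos (hw0 : 0 < w 0) {r : ℝ} (hr : 0 ≤ r) (hρ : ENNReal.ofReal r < rho w) :
    0 < realGen w r :=
  (NNReal.coe_pos.2 hw0).trans_le (le_realGen hr hρ)

theorem genFun_ofReal {r : ℝ} (hr : 0 ≤ r) (hρ : ENNReal.ofReal r < rho w) :
    genFun w (ENNReal.ofReal r) = ENNReal.ofReal (realGen w r) := by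
  rw [realGen, ENNReal.ofReal_tsum_of_nonneg (fun k => by positivity) (summable_weight hr hρ)]
  refine tsum_congr fun k => ?_
  rw [ENNReal.ofReal_mul (by positivity), ENNReal.ofReal_pow hr, ENNReal.ofReal_coe_nnreal]

theorem psiQuot_ofReal (hw0 : 0 < w 0) {r : ℝ} (hr : 0 ≤ r) (hρ : ENNReal.ofReal r < rho w) :
    psiQuot w (ENNReal.ofReal r) = ENNReal.ofReal (realPsi w r) := by
  rw [psiQuot, genFun_ofReal hr hρ, realPsi, ENNReal.ofReal_div_of_pos (realGen_pos hw0 hr hρ),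
    realNum, ENNReal.ofReal_tsum_of_nonneg (fun k => by positivity) (summable_mul_weight hr hρ)]
  congr 1
  refine tsum_congr fun k => ?_
  rw [ENNReal.ofReal_mul (by positivity), ENNReal.ofReal_mul (by positivity),
    ENNReal.ofReal_pow hr, ENNReal.ofReal_coe_nnreal, ENNReal.ofReal_natCast, mul_assoc]

theorem Psi_ofReal (hw0 : 0 < w 0) {r : ℝ} (hr : 0 ≤ r) (hρ : ENNReal.ofReal r < rho w) :
    Psi w (ENNReal.ofReal r) = ENNReal.ofReal (realPsi w r) := by
  rw [Psi, if_pos, psiQuot_ofReal hw0 hr hρ]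
  rw [genFun_ofReal hr hρ]; exact ENNReal.ofReal_lt_top

theorem realPsi_zero : realPsi w 0 = 0 := by
  have : realNum w 0 = 0 := by
    rw [realNum]
    convert tsum_zero with k
    rcases k with _ | k <;> simp
  rw [realPsi, this, zero_div]

theorem ofReal_lt_rho_mono {r s : ℝ} (h : r ≤ s) (hs : ENNReal.ofReal s < rho w) :
    ENNReal.ofReal r < rho w := (ENNReal.ofReal_le_ofReal h).trans_lt hs

theorem realNum_pos (hw : ∃ k, 1 ≤ k ∧ 0 < w k) {r : ℝ} (hr : 0 < r)
    (hρ : ENNReal.ofReal r < rho w) : 0 < realNum w r := by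
  obtain ⟨k, hk, hwk⟩ := hw
  refine (summable_mul_weight hr.le hρ).tsum_pos (fun k => by positivity) k ?_
  have : (0 : ℝ) < w k := hwk
  have : (0 : ℝ) < k := by exact_mod_cast hk
  positivity

theorem realPsi_pos (hw0 : 0 < w 0) (hw : ∃ k, 1 ≤ k ∧ 0 < w k) {r : ℝ} (hr : 0 < r)
    (hρ : ENNReal.ofReal r < rho w) : 0 < realPsi w r :=
  div_pos (realNum_pos hw hr hρ) (realGen_pos hw0 hr.le hρ)

/-- With `μ = Ψ(s)`, the sum of `(k - μ) w_k s^k` vanishes. Subtracting `(t/s)^μ` times it from the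
same sum at `t` leaves terms `w_k s^k (k - μ) ((t/s)^k - (t/s)^μ)`, whose last two factors have the
same sign; the term `k = 0` is strictly positive. -/
theorem realPsi_lt (hw0 : 0 < w 0) (hw : ∃ k, 1 ≤ k ∧ 0 < w k) {s t : ℝ} (hs : 0 ≤ s)
    (hst : s < t) (hρ : ENNReal.ofReal t < rho w) : realPsi w s < realPsi w t := by
  rcases hs.eq_or_lt with rfl | hs0
  · rw [realPsi_zero]; exact realPsi_pos hw0 hw hst hρ
  have ht0 := hs0.trans hst
  have hsρ := ofReal_lt_rho_mono hst.le hρ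
  set μ := realPsi w s with hμ
  have hμ0 : 0 < μ := realPsi_pos hw0 hw hs0 hsρ
  have hGs := realGen_pos hw0 hs hsρ
  have hGt := realGen_pos hw0 ht0.le hρ
  have hq : 1 < t / s := (one_lt_div hs0).2 hst
  have hA : HasSum (fun k : ℕ => ((k : ℝ) - μ) * ((w k : ℝ) * t ^ k))
      (realNum w t - μ * realGen w t) := by
    simp only [sub_mul]
    exact (hasSum_realNum ht0.le hρ).sub ((hasSum_realGen ht0.le hρ).mul_left μ)
  have hB : HasSum (fun k : ℕ => ((k : ℝ) - μ) * ((w k : ℝ) * s ^ k)) 0 := by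
    have : realNum w s - μ * realGen w s = 0 := by
      rw [hμ, realPsi]; field_simp; ring
    rw [← this]
    simp only [sub_mul]
    exact (hasSum_realNum hs hsρ).sub ((hasSum_realGen hs hsρ).mul_left μ)
  have hC := hA.sub (hB.mul_left ((t / s) ^ μ))
  have hkey : ∀ k : ℕ, ((k : ℝ) - μ) * ((w k : ℝ) * t ^ k)
      - (t / s) ^ μ * (((k : ℝ) - μ) * ((w k : ℝ) * s ^ k))
      = (w k * s ^ k) * (((k : ℝ) - μ) * ((t / s) ^ (k : ℝ) - (t / s) ^ μ)) := by
    intro k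
    rw [Real.rpow_natCast, div_pow]; field_simp
  simp only [hkey, mul_zero, sub_zero] at hC
  have hpos : 0 < realNum w t - μ * realGen w t := by
    rw [← hC.tsum_eq]
    refine hC.summable.tsum_pos (fun k => ?_) 0 ?_
    · refine mul_nonneg (by positivity) ?_
      rcases le_total (k : ℝ) μ with h | h
      · exact mul_nonneg_of_nonpos_of_nonpos (by linarith)
          (sub_nonpos.2 (Real.rpow_le_rpow_of_exponent_le hq.le h))
      · exact mul_nonneg (by linarith) (sub_nonneg.2 (Real.rpow_le_rpow_of_exponent_le hq.le h))
    · have h1 : (t / s) ^ ((0 : ℕ) : ℝ) < (t / s) ^ μ :=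
        Real.rpow_lt_rpow_of_exponent_lt hq (by simpa using hμ0)
      have h0 : (0 : ℝ) < w 0 := hw0
      refine mul_pos (by simpa using h0) (mul_pos_of_neg_of_neg (by simpa using hμ0) (by linarith))
  show μ < realNum w t / realGen w t
  rw [lt_div_iff₀ hGt]; linarith

theorem realPsi_le (hw0 : 0 < w 0) (hw : ∃ k, 1 ≤ k ∧ 0 < w k) {s t : ℝ} (hs : 0 ≤ s)
    (hst : s ≤ t) (hρ : ENNReal.ofReal t < rho w) : realPsi w s ≤ realPsi w t := by
  rcases hst.eq_or_lt with rfl | h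
  · rfl
  · exact (realPsi_lt hw0 hw hs h hρ).le

theorem continuousOn_realPsi (hw0 : 0 < w 0) {r : ℝ} (hr : 0 ≤ r)
    (hρ : ENNReal.ofReal r < rho w) : ContinuousOn (realPsi w) (Set.Icc 0 r) := by
  refine ContinuousOn.div (continuousOn_tsum (fun k => by fun_prop) (summable_mul_weight hr hρ) ?_)
    (continuousOn_tsum (fun k => by fun_prop) (summable_weight hr hρ) ?_)
    (fun x hx => (realGen_pos hw0 hx.1 (ofReal_lt_rho_mono hx.2 hρ)).ne')
  · rintro k x ⟨hx0, hxr⟩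
    rw [Real.norm_of_nonneg (by positivity)]; gcongr
  · rintro k x ⟨hx0, hxr⟩
    rw [Real.norm_of_nonneg (by positivity)]; gcongr

theorem exists_ofReal_eq_of_lt_rho {s : ℝ≥0∞} (hs : s < rho w) : ∃ r : ℝ, 0 ≤ r ∧ ENNReal.ofReal r = s :=
  ⟨s.toReal, ENNReal.toReal_nonneg, ENNReal.ofReal_toReal hs.ne_top⟩

theorem monotoneOn_psiQuot (hw0 : 0 < w 0) (hw : ∃ k, 1 ≤ k ∧ 0 < w k) :
    MonotoneOn (psiQuot w) (Set.Iio (rho w)) := by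
  intro a ha b hb hab
  obtain ⟨s, hs, rfl⟩ := exists_ofReal_eq_of_lt_rho ha
  obtain ⟨t, ht, rfl⟩ := exists_ofReal_eq_of_lt_rho hb
  rw [psiQuot_ofReal hw0 hs ha, psiQuot_ofReal hw0 ht hb]
  exact ENNReal.ofReal_le_ofReal
    (realPsi_le hw0 hw hs ((ENNReal.ofReal_le_ofReal_iff ht).1 hab) hb)

theorem genFun_mono {a b : ℝ≥0∞} (h : a ≤ b) : genFun w a ≤ genFun w b := by
  unfold genFun; gcongr

theorem le_genFun (t : ℝ≥0∞) : (w 0 : ℝ≥0∞) ≤ genFun w t := by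
  have := ENNReal.le_tsum (f := fun k : ℕ => (w k : ℝ≥0∞) * t ^ k) 0
  simpa [genFun] using this

theorem rho_pos {lam : ℝ} (hnu : ENNReal.ofReal lam < nu w) : 0 < rho w := by
  by_contra h
  have h0 : rho w = 0 := by simpa using h
  have hg : genFun w 0 = w 0 := by
    rw [genFun, tsum_eq_single 0 (fun k hk => by simp [hk])]; simp
  have : nu w = 0 := by
    rw [nu, h0, Psi, hg, if_pos ENNReal.coe_lt_top, psiQuot]
    have : (∑' k : ℕ, (k : ℝ≥0∞) * (w k : ℝ≥0∞) * 0 ^ k) = 0 := by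
      rw [ENNReal.tsum_eq_zero]
      intro k; rcases k with _ | k <;> simp
    rw [this, ENNReal.zero_div]
  simp [this] at hnu

/-- If `Φ(ρ) < ∞`, a finite partial sum of the numerator already exceeds `λ Φ(ρ)`; by continuity it
still does at some `s < ρ`, where `Φ(s) ≤ Φ(ρ)`. Otherwise `ν` is the left limit of a monotone
function, hence its supremum. -/
theorem exists_lt_realPsi (hw0 : 0 < w 0) (hw : ∃ k, 1 ≤ k ∧ 0 < w k) {lam : ℝ} (hlam : 0 < lam)
    (hnu : ENNReal.ofReal lam < nu w) :
    ∃ r : ℝ, 0 ≤ r ∧ ENNReal.ofReal r < rho w ∧ lam < realPsi w r := by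
  have hρ0 := rho_pos hnu
  suffices h : ∃ s < rho w, ENNReal.ofReal lam < psiQuot w s by
    obtain ⟨s, hs, hl⟩ := h
    obtain ⟨r, hr, rfl⟩ := exists_ofReal_eq_of_lt_rho hs
    refine ⟨r, hr, hs, ?_⟩
    rw [psiQuot_ofReal hw0 hr hs] at hl
    exact (ENNReal.ofReal_lt_ofReal_iff_of_nonneg hlam.le).1 hl
  have hne : (𝓝[<] (rho w)).NeBot := nhdsLT_neBot_of_exists_lt ⟨0, hρ0⟩
  rw [nu, Psi] at hnu
  split_ifs at hnu with hfin
  · have hG0 : genFun w (rho w) ≠ 0 := fun h => by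
      have := le_genFun (w := w) (rho w)
      rw [h] at this
      simp [hw0.ne'] at this
    rw [psiQuot, ENNReal.lt_div_iff_mul_lt (Or.inl hG0) (Or.inl hfin.ne),
      ENNReal.tsum_eq_iSup_sum, lt_iSup_iff] at hnu
    obtain ⟨F, hF⟩ := hnu
    have hcont : Continuous fun t : ℝ≥0∞ =>
        ∑ k ∈ F, (k : ℝ≥0∞) * (w k : ℝ≥0∞) * t ^ k := by
      refine continuous_finsetSum _ fun k _ => ?_
      exact (ENNReal.continuous_const_mul
        (ENNReal.mul_ne_top (ENNReal.natCast_ne_top k) ENNReal.coe_ne_top)).comp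
          (ENNReal.continuous_pow k)
    have hev := (hcont.tendsto (rho w)).eventually (lt_mem_nhds hF)
    obtain ⟨s, hs, hsρ⟩ := ((hev.filter_mono nhdsWithin_le_nhds).and
      (self_mem_nhdsWithin : Set.Iio (rho w) ∈ 𝓝[<] (rho w))).exists
    refine ⟨s, hsρ, ?_⟩
    have hsG := genFun_mono (w := w) (le_of_lt hsρ)
    rw [psiQuot, ENNReal.lt_div_iff_mul_lt (Or.inl ?_) (Or.inl (hsG.trans_lt hfin).ne)]
    · calc ENNReal.ofReal lam * genFun w s ≤ ENNReal.ofReal lam * genFun w (rho w) := by gcongr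
        _ < _ := hs
        _ ≤ _ := ENNReal.sum_le_tsum F
    · exact ((ENNReal.coe_pos.2 hw0).trans_le (le_genFun s)).ne'
  · rw [((monotoneOn_psiQuot hw0 hw).tendsto_nhdsLT (OrderTop.bddAbove _)).limUnder_eq,
      lt_sSup_iff] at hnu
    obtain ⟨_, ⟨s, hs, rfl⟩, hl⟩ := hnu
    exact ⟨s, hs, hl⟩

theorem exists_realPsi_eq (hw0 : 0 < w 0) {r : ℝ} (hr : 0 ≤ r) (hρ : ENNReal.ofReal r < rho w)
    {x : ℝ} (hx0 : 0 ≤ x) (hx : x ≤ realPsi w r) : ∃ t ∈ Set.Icc 0 r, realPsi w t = x := by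
  have := intermediate_value_Icc hr (continuousOn_realPsi hw0 hr hρ)
  rw [realPsi_zero] at this
  exact this ⟨hx0, hx⟩

/-- The solution `τ` of `Ψ(τ) = λ`, together with the uniqueness of this solution on `[0,ρ]`. -/
theorem exists_tau (hw0 : 0 < w 0) (hw : ∃ k, 1 ≤ k ∧ 0 < w k) {lam : ℝ} (hlam : 0 < lam)
    (hnu : ENNReal.ofReal lam < nu w) :
    ∃ τ : ℝ, 0 < τ ∧ ENNReal.ofReal τ < rho w ∧ realPsi w τ = lam ∧
      (∃ R, τ < R ∧ ENNReal.ofReal R < rho w) ∧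
      ∀ s ≤ rho w, Psi w s = ENNReal.ofReal lam → s = ENNReal.ofReal τ := by
  obtain ⟨r, hr, hrρ, hlr⟩ := exists_lt_realPsi hw0 hw hlam hnu
  obtain ⟨τ, ⟨hτ0, hτr⟩, hτ⟩ := exists_realPsi_eq hw0 hr hrρ hlam.le hlr.le
  have hτpos : 0 < τ := by
    rcases hτ0.eq_or_lt with rfl | h
    · rw [realPsi_zero] at hτ; exact absurd hτ hlam.ne
    · exact h
  have hτr' : τ < r := by
    rcases hτr.eq_or_lt with rfl | h
    · exact absurd hτ hlr.ne'
    · exact h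
  refine ⟨τ, hτpos, ofReal_lt_rho_mono hτr hrρ, hτ, ⟨r, hτr', hrρ⟩, fun s hs hs' => ?_⟩
  -- The endpoint is no solution, because `Ψ(ρ) = ν > λ`.
  rcases hs.eq_or_lt with rfl | hs
  · exact absurd hs' hnu.ne'
  obtain ⟨t, ht, rfl⟩ := exists_ofReal_eq_of_lt_rho hs
  rw [Psi_ofReal hw0 ht hs] at hs'
  have hpt : 0 < realPsi w t := by
    rw [← ENNReal.ofReal_pos, hs']; exact ENNReal.ofReal_pos.2 hlam
  rw [ENNReal.ofReal_eq_ofReal_iff hpt.le hlam.le] at hs'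
  congr 1
  rcases lt_trichotomy t τ with h | h | h
  · have := realPsi_lt hw0 hw ht h (ofReal_lt_rho_mono hτr hrρ); linarith
  · exact h
  · have := realPsi_lt hw0 hw hτ0 h hs; linarith

/-- Solutions `τ_i` of `Ψ(τ_i) = x_i` where `x_i → λ`. -/
theorem exists_tendsto_tau (hw0 : 0 < w 0) (hw : ∃ k, 1 ≤ k ∧ 0 < w k) {τ R : ℝ} (hτ : 0 < τ)
    (hR : τ < R) (hRρ : ENNReal.ofReal R < rho w) {x : ℕ → ℝ}
    (hx : Tendsto x atTop (𝓝 (realPsi w τ))) :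
    ∃ T : ℕ → ℝ, (∀ᶠ i in atTop, realPsi w (T i) = x i) ∧ Tendsto T atTop (𝓝 τ) := by
  have hτρ := ofReal_lt_rho_mono hR.le hRρ
  have hpos := realPsi_pos hw0 hw hτ hτρ
  have hlt := realPsi_lt hw0 hw hτ.le hR hRρ
  have hex : ∀ i, ∃ t, 0 ≤ x i → x i ≤ realPsi w R → t ∈ Set.Icc 0 R ∧ realPsi w t = x i := by
    intro i
    by_cases h : 0 ≤ x i ∧ x i ≤ realPsi w R
    · obtain ⟨t, ht, ht'⟩ := exists_realPsi_eq hw0 (hτ.le.trans hR.le) hRρ h.1 h.2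
      exact ⟨t, fun _ _ => ⟨ht, ht'⟩⟩
    · exact ⟨0, fun h1 h2 => absurd ⟨h1, h2⟩ h⟩
  choose T hT using hex
  have hev : ∀ᶠ i in atTop, T i ∈ Set.Icc 0 R ∧ realPsi w (T i) = x i := by
    filter_upwards [hx.eventually (lt_mem_nhds hpos), hx.eventually (gt_mem_nhds hlt)] with i h1 h2
    exact hT i h1.le h2.le
  refine ⟨T, hev.mono fun i h => h.2, ?_⟩
  -- Strict monotonicity of `Ψ` replaces continuity of its inverse: if `T i` were on the wrong side
  -- of `a`, then `x i` would be on the wrong side of `Ψ(a)`.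
  rw [tendsto_order]
  constructor
  · intro a ha
    rcases lt_or_ge a 0 with h0 | h0
    · exact hev.mono fun i h => h0.trans_le h.1.1
    · have h1 := realPsi_lt hw0 hw h0 ha hτρ
      filter_upwards [hev, hx.eventually (lt_mem_nhds h1)] with i hi h2
      by_contra! h3
      have := realPsi_le hw0 hw hi.1.1 h3 (ofReal_lt_rho_mono (ha.le.trans hR.le) hRρ)
      linarith [hi.2]
  · intro a ha
    rcases lt_or_ge R a with h0 | h0
    · exact hev.mono fun i h => h.1.2.trans_lt h0
    · have h1 := realPsi_lt hw0 hw hτ.le ha (ofReal_lt_rho_mono h0 hRρ)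
      filter_upwards [hev, hx.eventually (gt_mem_nhds h1)] with i hi h2
      by_contra! h3
      have := realPsi_le hw0 hw (hτ.le.trans ha.le) h3 (ofReal_lt_rho_mono hi.1.2 hRρ)
      linarith [hi.2]

/-! ### Fourier inversion -/

/-- The characteristic function `∑ u_k e^{ikt}` of a summable sequence. -/
noncomputable def charSum (u : ℕ → ℝ) (t : ℝ) : ℂ :=
  ∑' k : ℕ, (u k : ℂ) * Complex.exp (((k : ℝ) * t : ℝ) * Complex.I)

theorem norm_mul_exp (a x : ℝ) : ‖(a : ℂ) * Complex.exp ((x : ℝ) * Complex.I)‖ = |a| := by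
  rw [norm_mul, Complex.norm_exp_ofReal_mul_I, mul_one, Complex.norm_real, Real.norm_eq_abs]

theorem summable_charSum {u : ℕ → ℝ} (hu : Summable u) (h0 : ∀ k, 0 ≤ u k) (t : ℝ) :
    Summable fun k : ℕ => (u k : ℂ) * Complex.exp (((k : ℝ) * t : ℝ) * Complex.I) := by
  refine Summable.of_norm (hu.congr fun k => ?_)
  rw [norm_mul_exp, abs_of_nonneg (h0 k)]

theorem norm_charSum_le {u : ℕ → ℝ} (hu : Summable u) (h0 : ∀ k, 0 ≤ u k) (t : ℝ) :
    ‖charSum u t‖ ≤ ∑' k, u k :=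
  tsum_of_norm_bounded hu.hasSum fun k => by rw [norm_mul_exp, abs_of_nonneg (h0 k)]

theorem continuous_charSum {u : ℕ → ℝ} (hu : Summable u) (h0 : ∀ k, 0 ≤ u k) :
    Continuous (charSum u) :=
  continuous_tsum (fun k => by fun_prop) hu
    fun k t => by rw [norm_mul_exp, abs_of_nonneg (h0 k)]

/-- All frequencies are multiples of `d`, so orthogonality already holds on an interval of length
`2π/d`. The short interval matters: at the nonzero multiples of `2π/d`, the characteristic function
of a law on `dℕ` again has modulus one. -/
theorem integral_exp_eq {d : ℕ} (hd : 0 < d) (j : ℤ) :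
    ∫ t in -(Real.pi / d)..(Real.pi / d), Complex.exp (((j * d : ℝ) * t : ℝ) * Complex.I) =
      if j = 0 then ((2 * Real.pi / d : ℝ) : ℂ) else 0 := by
  have hd' : (d : ℝ) ≠ 0 := by positivity
  have hdc : (d : ℂ) ≠ 0 := by exact_mod_cast hd'
  split_ifs with hj
  · simp only [hj, Int.cast_zero, zero_mul, Complex.ofReal_zero, Complex.exp_zero]
    rw [intervalIntegral.integral_const, Complex.real_smul, mul_one]
    congr 1; ring
  · have hc : ((j * d : ℝ) : ℂ) * Complex.I ≠ 0 := by
      refine mul_ne_zero ?_ Complex.I_ne_zero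
      exact_mod_cast mul_ne_zero (Int.cast_ne_zero.2 hj) hd'
    have : ∀ t : ℝ, Complex.exp (((j * d : ℝ) * t : ℝ) * Complex.I)
        = Complex.exp ((((j * d : ℝ) : ℂ) * Complex.I) * t) := by
      intro t; congr 1; push_cast; ring
    simp only [this]
    rw [integral_exp_mul_complex hc, div_eq_zero_iff]
    left
    have e : ((j * d : ℝ) : ℂ) * Complex.I * ((Real.pi / d : ℝ) : ℂ)
        = ((j * d : ℝ) : ℂ) * Complex.I * ((-(Real.pi / d) : ℝ) : ℂ)
          + (j : ℂ) * (2 * Real.pi * Complex.I) := by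
      push_cast; field_simp; ring
    rw [e, Complex.exp_add, Complex.exp_int_mul_two_pi_mul_I, mul_one, sub_self]

/-- Cutting off at `M ≥ m` makes the product a finite sum and loses no allocation, since no box
holds more than `m` balls. -/
theorem integral_prod_truncated {d m n M : ℕ} (hd : 0 < d) (hdm : d ∣ m) (hM : m ≤ M)
    (u : Fin n → ℕ → ℝ) (hu : ∀ i k, u i k ≠ 0 → d ∣ k) :
    ∫ t in -(Real.pi / d)..(Real.pi / d),
      (∏ i, ∑ k ∈ Finset.range (M + 1), (u i k : ℂ) * Complex.exp (((k : ℝ) * t : ℝ) * Complex.I)) *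
        Complex.exp ((-(m * t) : ℝ) * Complex.I) =
      (2 * Real.pi / d : ℝ) * ((∑ y ∈ allocations m n, ∏ i, u i (y i) : ℝ) : ℂ) := by
  have hexp : ∀ t : ℝ,
      (∏ i, ∑ k ∈ Finset.range (M + 1), (u i k : ℂ) * Complex.exp (((k : ℝ) * t : ℝ) * Complex.I)) *
        Complex.exp ((-(m * t) : ℝ) * Complex.I) =
      ∑ y ∈ Fintype.piFinset fun _ : Fin n => Finset.range (M + 1), ((∏ i, u i (y i) : ℝ) : ℂ) *
        Complex.exp (((((∑ i, y i : ℕ) : ℝ) - m) * t : ℝ) * Complex.I) := by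
    intro t
    rw [Finset.prod_univ_sum, Finset.sum_mul]
    refine Finset.sum_congr rfl fun y _ => ?_
    rw [Finset.prod_mul_distrib, ← Complex.exp_sum, mul_assoc, ← Complex.exp_add]
    push_cast
    congr 2
    rw [sub_mul, sub_mul, Finset.sum_mul, Finset.sum_mul]
    ring
  simp only [hexp]
  rw [intervalIntegral.integral_finsetSum
    (fun y _ => Continuous.intervalIntegrable (by fun_prop) _ _)]
  simp only [intervalIntegral.integral_const_mul]
  have hterm : ∀ y : Fin n → ℕ, ((∏ i, u i (y i) : ℝ) : ℂ) *
      ∫ t in -(Real.pi / d)..(Real.pi / d),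
        Complex.exp (((((∑ i, y i : ℕ) : ℝ) - m) * t : ℝ) * Complex.I)
      = if ∑ i, y i = m then (2 * Real.pi / d : ℝ) * ((∏ i, u i (y i) : ℝ) : ℂ) else 0 := by
    intro y
    by_cases h0 : ∏ i, u i (y i) = 0
    · simp [h0]
    · have hdy : d ∣ ∑ i, y i :=
        Finset.dvd_sum fun i _ => hu i (y i) fun h => h0 (Finset.prod_eq_zero (Finset.mem_univ i) h)
      obtain ⟨a, ha⟩ := hdy
      obtain ⟨b, hb⟩ := hdm
      have : (((∑ i, y i : ℕ) : ℝ) - m) = (((a : ℤ) - b : ℤ) : ℝ) * d := by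
        rw [ha, hb]; push_cast; ring
      rw [this, integral_exp_eq hd, ha, hb]
      have hiff : ((a : ℤ) - b = 0) ↔ d * a = d * b := by
        rw [Nat.mul_right_inj hd.ne']; omega
      simp only [hiff]
      split_ifs
      · rw [mul_comm]
      · simp
  simp only [hterm]
  rw [← Finset.sum_filter, ← Finset.mul_sum]
  congr 1
  rw [Complex.ofReal_sum]
  refine Finset.sum_congr ?_ fun _ _ => rfl
  ext y
  simp only [Finset.mem_filter, Fintype.mem_piFinset, Finset.mem_range, mem_allocations,
    and_iff_right_iff_imp]
  intro hy i
  have := Finset.single_le_sum (f := y) (fun i _ => Nat.zero_le _) (Finset.mem_univ i)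
  omega

theorem integral_prod_charSum {d m n : ℕ} (hd : 0 < d) (hdm : d ∣ m) (u : Fin n → ℕ → ℝ)
    (h0 : ∀ i k, 0 ≤ u i k) (hs : ∀ i, Summable (u i)) (hu : ∀ i k, u i k ≠ 0 → d ∣ k) :
    ∫ t in -(Real.pi / d)..(Real.pi / d),
      (∏ i, charSum (u i) t) * Complex.exp ((-(m * t) : ℝ) * Complex.I) =
      (2 * Real.pi / d : ℝ) * ((∑ y ∈ allocations m n, ∏ i, u i (y i) : ℝ) : ℂ) := by
  have hlim : Tendsto (fun M : ℕ => ∫ t in -(Real.pi / d)..(Real.pi / d),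
      (∏ i, ∑ k ∈ Finset.range (M + 1), (u i k : ℂ) * Complex.exp (((k : ℝ) * t : ℝ) * Complex.I)) *
        Complex.exp ((-(m * t) : ℝ) * Complex.I)) atTop
      (𝓝 (∫ t in -(Real.pi / d)..(Real.pi / d),
        (∏ i, charSum (u i) t) * Complex.exp ((-(m * t) : ℝ) * Complex.I))) := by
    refine intervalIntegral.tendsto_integral_filter_of_dominated_convergence
      (fun _ => ∏ i, ∑' k, u i k) ?_ ?_ intervalIntegrable_const ?_
    · exact Eventually.of_forall fun M => Continuous.aestronglyMeasurable (by fun_prop)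
    · refine Eventually.of_forall fun M => Eventually.of_forall fun t _ => ?_
      rw [norm_mul, Complex.norm_exp_ofReal_mul_I, mul_one, norm_prod]
      refine Finset.prod_le_prod (fun i _ => norm_nonneg _) fun i _ => ?_
      refine (norm_sum_le _ _).trans ?_
      simp only [norm_mul_exp, abs_of_nonneg (h0 i _)]
      exact (hs i).sum_le_tsum _ fun k _ => h0 i k
    · refine Eventually.of_forall fun t _ => Tendsto.mul_const _ ?_
      refine tendsto_finsetProd _ fun i _ => ?_
      exact (summable_charSum (hs i) (h0 i) t).hasSum.tendsto_sum_nat.comp (tendsto_add_atTop_nat 1)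
  -- The truncated integrals do not depend on `M` once `M ≥ m`.
  refine tendsto_nhds_unique hlim (tendsto_const_nhds.congr' ?_)
  filter_upwards [eventually_ge_atTop m] with M hM
  exact (integral_prod_truncated hd hdm hM u hu).symm

/-! ### Bounds on characteristic functions -/

/-- The squared modulus is `(a + b)^2 - 2ab(1 - cos θ)`; because `a + b ≤ 1`, this is at most the
square of the right-hand side. -/
theorem norm_two_point_le {a b θ : ℝ} (ha : 0 ≤ a) (hb : 0 ≤ b) (hab : a + b ≤ 1) :
    ‖(a : ℂ) + b * Complex.exp ((θ : ℝ) * Complex.I)‖ ≤ a + b - a * b * (1 - Real.cos θ) := by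
  have hc1 := Real.neg_one_le_cos θ
  have hc2 := Real.cos_le_one θ
  have hsq : ‖(a : ℂ) + b * Complex.exp ((θ : ℝ) * Complex.I)‖ ^ 2
      = (a + b) ^ 2 - 2 * (a * b) * (1 - Real.cos θ) := by
    rw [Complex.sq_norm, Complex.normSq_apply]
    simp only [Complex.add_re, Complex.ofReal_re, Complex.re_ofReal_mul, Complex.exp_ofReal_mul_I_re,
      Complex.add_im, Complex.ofReal_im, Complex.im_ofReal_mul, Complex.exp_ofReal_mul_I_im]
    linear_combination b ^ 2 * Real.sin_sq_add_cos_sq θ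
  have hab0 : 0 ≤ a * b := mul_nonneg ha hb
  refine abs_le_of_sq_le_sq' ?_ ?_ |>.2
  · rw [hsq]
    nlinarith [mul_nonneg hab0 (sub_nonneg.2 hc2), sq_nonneg (a * b * (1 - Real.cos θ))]
  · nlinarith [sq_nonneg (a - b), mul_nonneg hab0 (sub_nonneg.2 hc2)]

/-- Only the interference between the atoms at `0` and `k` is kept; the remaining mass is bounded by
the triangle inequality. -/
theorem norm_charSum_le_one_sub {p : ℕ → ℝ} (hs : HasSum p 1) (h0 : ∀ k, 0 ≤ p k) {k : ℕ}
    (hk : 1 ≤ k) (t : ℝ) :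
    ‖charSum p t‖ ≤ 1 - p 0 * p k * (1 - Real.cos (k * t)) := by
  have hsc := (summable_charSum hs.summable h0 t)
  have hk0 : (0 : ℕ) ≠ k := by omega
  have hsum2 : ∀ f : ℕ → ℂ, ∑ x ∈ ({0, k} : Finset ℕ), f x = f 0 + f k :=
    fun f => Finset.sum_pair hk0
  have h1 := hsc.sum_add_tsum_compl (s := {0, k})
  have h2 := hs.summable.sum_add_tsum_compl (s := {0, k})
  rw [hs.tsum_eq, Finset.sum_pair hk0] at h2
  rw [hsum2] at h1
  have hsub : Summable fun x : ((({0, k} : Finset ℕ) : Set ℕ)ᶜ : Set ℕ) => p x :=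
    hs.summable.subtype _
  have h3 : ‖∑' x : ((({0, k} : Finset ℕ) : Set ℕ)ᶜ : Set ℕ),
      (p x : ℂ) * Complex.exp ((((x : ℕ) : ℝ) * t : ℝ) * Complex.I)‖
      ≤ ∑' x : ((({0, k} : Finset ℕ) : Set ℕ)ᶜ : Set ℕ), p x :=
    tsum_of_norm_bounded hsub.hasSum fun x => by rw [norm_mul_exp, abs_of_nonneg (h0 _)]
  have h4 : 0 ≤ ∑' x : ((({0, k} : Finset ℕ) : Set ℕ)ᶜ : Set ℕ), p x :=
    tsum_nonneg fun x => h0 _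
  have h5 := norm_two_point_le (θ := k * t) (h0 0) (h0 k) (by linarith)
  rw [charSum, ← h1]
  refine (norm_add_le _ _).trans ?_
  simp only [Nat.cast_zero, zero_mul, Complex.ofReal_zero, Complex.exp_zero, mul_one]
  linarith

/-- A finite set `F` of positive elements of `S` whose gcd divides every element of `S`. -/
theorem exists_finset_gcd_dvd (S : Set ℕ) (hS : ∃ k, 1 ≤ k ∧ k ∈ S) :
    ∃ F : Finset ℕ, F.Nonempty ∧ (∀ k ∈ F, 1 ≤ k ∧ k ∈ S) ∧ 0 < F.gcd id ∧
      ∀ k ∈ S, F.gcd id ∣ k := by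
  classical
  obtain ⟨k₀, hk₀, hk₀S⟩ := hS
  -- A finite set with the smallest possible gcd works: adjoining another element of `S` cannot
  -- lower the gcd, so the gcd divides that element.
  let P : ℕ → Prop := fun d => ∃ F : Finset ℕ, F.Nonempty ∧ (∀ k ∈ F, 1 ≤ k ∧ k ∈ S) ∧ F.gcd id = d
  have hP : ∃ d, P d := ⟨_, {k₀}, by simp, by simp [hk₀, hk₀S], rfl⟩
  obtain ⟨F, hF, hFS, hFd⟩ := Nat.find_spec hP
  have hpos : 0 < F.gcd id := by
    obtain ⟨k, hk⟩ := hF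
    rw [Nat.pos_iff_ne_zero, Ne, Finset.gcd_eq_zero_iff]
    intro h
    have := h k hk
    have := (hFS k hk).1
    simp at *; omega
  refine ⟨F, hF, hFS, hpos, fun k hk => ?_⟩
  rcases Nat.eq_zero_or_pos k with rfl | hk1
  · exact dvd_zero _
  have hle : F.gcd id ≤ (insert k F).gcd id := by
    rw [hFd]
    refine Nat.find_min' hP ⟨insert k F, Finset.insert_nonempty _ _, ?_, rfl⟩
    intro j hj
    rcases Finset.mem_insert.1 hj with rfl | hj
    · exact ⟨hk1, hk⟩
    · exact hFS j hj
  rw [Finset.gcd_insert] at hle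
  have h1 : gcd (id k) (F.gcd id) ∣ F.gcd id := gcd_dvd_right _ _
  have h2 := Nat.le_antisymm (Nat.le_of_dvd hpos h1) hle
  have h3 : gcd (id k) (F.gcd id) ∣ k := gcd_dvd_left _ _
  rwa [h2] at h3

/-- The order of `e^{it}` divides every `k ∈ F`, hence their gcd `d`. So `dt` is a multiple of `2π`,
and `|dt| ≤ π` leaves only zero. -/
theorem eq_zero_of_cos_eq_one {F : Finset ℕ} (hpos : 0 < F.gcd id) {t : ℝ}
    (ht : |t| ≤ Real.pi / F.gcd id) (h : ∀ k ∈ F, Real.cos (k * t) = 1) : t = 0 := by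
  set d := F.gcd id with hd
  set z : ℂ := Complex.exp ((t : ℝ) * Complex.I) with hz
  have hzk : ∀ k : ℕ, z ^ k = Complex.exp (((k * t : ℝ) : ℂ) * Complex.I) := by
    intro k; rw [hz, ← Complex.exp_nat_mul]; congr 1; push_cast; ring
  have h1 : ∀ k ∈ F, z ^ k = 1 := by
    intro k hk
    have hc := h k hk
    have hsin : Real.sin (k * t) = 0 := by
      have := Real.sin_sq_add_cos_sq (k * t); rw [hc] at this; nlinarith
    rw [hzk, Complex.exp_mul_I, ← Complex.ofReal_cos, ← Complex.ofReal_sin, hc, hsin]; simp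
  have h2 : orderOf z ∣ d := Finset.dvd_gcd fun k hk => orderOf_dvd_of_pow_eq_one (h1 k hk)
  have h3 : z ^ d = 1 := orderOf_dvd_iff_pow_eq_one.1 h2
  rw [hzk] at h3
  have h4 : Real.cos (d * t) = 1 := by
    have := congrArg Complex.re h3
    rwa [Complex.exp_ofReal_mul_I_re, Complex.one_re] at this
  have hd0 : (0 : ℝ) < d := by exact_mod_cast hpos
  have h5 : |(d : ℝ) * t| ≤ Real.pi := by
    rw [abs_mul, abs_of_pos hd0]; rw [le_div_iff₀ hd0] at ht; linarith
  have h6 := (abs_le.1 h5)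
  have := (Real.cos_eq_one_iff_of_lt_of_lt (by linarith [Real.pi_pos]) (by linarith [Real.pi_pos])).1 h4
  rcases mul_eq_zero.1 this with h | h
  · exact absurd h hd0.ne'
  · exact h

/-- For `|t| ≤ π/k` the single term of one `k ∈ F` is quadratically large. The rest of the interval
is compact, and there the sum has a positive minimum by `eq_zero_of_cos_eq_one`. -/
theorem exists_sq_le_sum_one_sub_cos {F : Finset ℕ} (hF : F.Nonempty) (hF1 : ∀ k ∈ F, 1 ≤ k) :
    ∃ c > 0, ∀ t : ℝ, |t| ≤ Real.pi / F.gcd id → c * t ^ 2 ≤ ∑ k ∈ F, (1 - Real.cos (k * t)) := by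
  have hπ := Real.pi_pos
  obtain ⟨k, hk⟩ := hF
  have hk1 := hF1 k hk
  have hkR : (1 : ℝ) ≤ k := by exact_mod_cast hk1
  have hpos : 0 < F.gcd id := by
    rw [Nat.pos_iff_ne_zero, Ne, Finset.gcd_eq_zero_iff]
    intro h
    have := h k hk
    simp at this; omega
  set d := F.gcd id with hd
  have hd0 : (0 : ℝ) < d := by exact_mod_cast hpos
  have hterm : ∀ t : ℝ, ∀ j ∈ F, 0 ≤ 1 - Real.cos (j * t) :=
    fun t j _ => sub_nonneg.2 (Real.cos_le_one _)
  let K : Set ℝ := Set.Icc (-(Real.pi / d)) (Real.pi / d) \ Set.Ioo (-(Real.pi / k)) (Real.pi / k)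
  have hK : IsCompact K := isCompact_Icc.diff isOpen_Ioo
  have hcont : ContinuousOn (fun t : ℝ => ∑ k ∈ F, (1 - Real.cos (k * t))) K := by fun_prop
  have hsmall : ∀ t : ℝ, |t| ≤ Real.pi / k →
      2 / Real.pi ^ 2 * t ^ 2 ≤ ∑ k ∈ F, (1 - Real.cos (k * t)) := by
    intro t ht
    have h1 : |(k : ℝ) * t| ≤ Real.pi := by
      rw [abs_mul, abs_of_pos (by linarith)]; rw [le_div_iff₀ (by linarith)] at ht; linarith
    have h2 := Real.cos_le_one_sub_mul_cos_sq h1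
    have h3 := Finset.single_le_sum (hterm t) hk
    refine le_trans ?_ h3
    have h4 : t ^ 2 ≤ (k * t) ^ 2 := by
      rw [mul_pow]; nlinarith [sq_nonneg t, mul_le_mul hkR hkR zero_le_one (by linarith)]
    have h5 : 2 / Real.pi ^ 2 * t ^ 2 ≤ 2 / Real.pi ^ 2 * (k * t) ^ 2 := by gcongr
    linarith
  have hbig : ∃ c > 0, ∀ t ∈ K, c ≤ ∑ k ∈ F, (1 - Real.cos (k * t)) := by
    rcases K.eq_empty_or_nonempty with hE | hne
    · exact ⟨1, one_pos, by simp [hE]⟩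
    obtain ⟨t₀, ht₀, hmin⟩ := hK.exists_isMinOn hne hcont
    refine ⟨_, ?_, fun t ht => hmin ht⟩
    refine (Finset.sum_nonneg (hterm t₀)).lt_of_ne' fun h => ?_
    rw [Finset.sum_eq_zero_iff_of_nonneg (hterm t₀)] at h
    have : t₀ = 0 := eq_zero_of_cos_eq_one hpos (abs_le.2 ht₀.1) fun j hj => by
      have := h j hj; linarith
    apply ht₀.2
    rw [this]
    have : 0 < Real.pi / k := by positivity
    exact ⟨by linarith, this⟩
  obtain ⟨c, hc, hcK⟩ := hbig
  refine ⟨min (2 / Real.pi ^ 2) (c / (Real.pi / d) ^ 2), by positivity, fun t ht => ?_⟩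
  rcases le_or_gt (|t|) (Real.pi / k) with h | h
  · exact (mul_le_mul_of_nonneg_right (min_le_left _ _) (sq_nonneg t)).trans (hsmall t h)
  · have htK : t ∈ K := ⟨abs_le.1 ht, fun hh => absurd (abs_lt.2 hh) h.not_gt⟩
    refine le_trans ?_ (hcK t htK)
    refine (mul_le_mul_of_nonneg_right (min_le_right _ _) (sq_nonneg t)).trans ?_
    have : t ^ 2 ≤ (Real.pi / d) ^ 2 := sq_le_sq.2 (by rwa [abs_of_pos (by positivity : 0 < Real.pi / d)])
    rw [div_mul_eq_mul_div, div_le_iff₀ (by positivity)]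
    gcongr

/-- Gaussian domination of the characteristic function on `[-π/d, π/d]`. -/
theorem norm_charSum_le_exp {F : Finset ℕ} (hF : F.Nonempty) (hF1 : ∀ k ∈ F, 1 ≤ k) {a : ℝ}
    (ha : 0 < a) :
    ∃ c > 0, ∀ p : ℕ → ℝ, HasSum p 1 → (∀ k, 0 ≤ p k) → (∀ k ∈ F, a ≤ p 0 * p k) →
      ∀ t : ℝ, |t| ≤ Real.pi / F.gcd id → ‖charSum p t‖ ≤ Real.exp (-c * t ^ 2) := by
  obtain ⟨c, hc, hcF⟩ := exists_sq_le_sum_one_sub_cos hF hF1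
  have hcard : (0 : ℝ) < F.card := by exact_mod_cast hF.card_pos
  -- Averaging the one-atom bounds over `F` gives this constant. It depends only on `F` and `a`, so
  -- it serves all tilts at once.
  refine ⟨a * c / F.card, by positivity, fun p hs h0 hap t ht => ?_⟩
  have h1 : ∀ k ∈ F, a * (1 - Real.cos (k * t)) ≤ 1 - ‖charSum p t‖ := by
    intro k hk
    have := norm_charSum_le_one_sub hs h0 (hF1 k hk) t
    have h2 := mul_le_mul_of_nonneg_right (hap k hk) (sub_nonneg.2 (Real.cos_le_one (k * t)))
    linarith
  have h2 := Finset.sum_le_sum h1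
  rw [← Finset.mul_sum, Finset.sum_const, nsmul_eq_mul] at h2
  have h3 := hcF t ht
  have h4 : a * c / F.card * t ^ 2 ≤ 1 - ‖charSum p t‖ := by
    rw [div_mul_eq_mul_div, div_le_iff₀ hcard]
    nlinarith
  have h5 := Real.add_one_le_exp (-(a * c / F.card) * t ^ 2)
  linarith

/-! ### Local limit estimates -/

/-- Each box of `B` contributes at most the mass of `A` to the Fourier integrand. The other boxes,
at least `n/2` of them, supply the Gaussian decay whose integral is of order `n^(-1/2)`. -/
theorem sum_restricted_le {d m n : ℕ} (hd : 0 < d) (hdm : d ∣ m) (hn : 0 < n) {p : ℕ → ℝ}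
    (hs : HasSum p 1) (h0 : ∀ k, 0 ≤ p k) (hp : ∀ k, p k ≠ 0 → d ∣ k) {c : ℝ} (hc : 0 < c)
    (hφ : ∀ t : ℝ, |t| ≤ Real.pi / d → ‖charSum p t‖ ≤ Real.exp (-c * t ^ 2))
    (B : Finset (Fin n)) (hB : 2 * B.card ≤ n) (A : Set ℕ) :
    ∑ y ∈ allocations m n, ∏ i, (if i ∈ B then A.indicator p else p) (y i) ≤
      d / (2 * Real.pi) * √(2 * Real.pi / c) / √n * (∑' k, A.indicator p k) ^ B.card := by
  have hπ := Real.pi_pos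
  have hd0 : (0 : ℝ) < d := by exact_mod_cast hd
  have hn0 : (0 : ℝ) < n := by exact_mod_cast hn
  set Q := ∑' k, A.indicator p k with hQ
  have hA0 : ∀ k, 0 ≤ A.indicator p k := fun k => Set.indicator_nonneg (fun k _ => h0 k) k
  have hAs : Summable (A.indicator p) := hs.summable.indicator A
  have hQ0 : 0 ≤ Q := tsum_nonneg hA0
  set S := ∑ y ∈ allocations m n, ∏ i, (if i ∈ B then A.indicator p else p) (y i) with hS
  have hF := integral_prod_charSum hd hdm
    (fun i : Fin n => if i ∈ B then A.indicator p else p)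
    (fun i k => by split_ifs <;> [exact hA0 k; exact h0 k])
    (fun i => by split_ifs <;> [exact hAs; exact hs.summable])
    (fun i k => by
      split_ifs
      · intro h; exact hp k fun h' => h (by simp [h'])
      · exact hp k)
  rw [← hS] at hF
  have hS0 : 0 ≤ S := Finset.sum_nonneg fun y _ => Finset.prod_nonneg fun i _ => by
    split_ifs <;> [exact hA0 _; exact h0 _]
  have hpt : ∀ t ∈ Set.Ioc (-(Real.pi / d)) (Real.pi / d),
      ‖(∏ i : Fin n, charSum (if i ∈ B then A.indicator p else p) t) *
        Complex.exp ((-(m * t) : ℝ) * Complex.I)‖ ≤ Q ^ B.card * Real.exp (-(c * n / 2) * t ^ 2) := by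
    intro t ht
    have htd : |t| ≤ Real.pi / d := abs_le.2 ⟨ht.1.le, ht.2⟩
    rw [norm_mul, Complex.norm_exp_ofReal_mul_I, mul_one, norm_prod]
    calc ∏ i : Fin n, ‖charSum (if i ∈ B then A.indicator p else p) t‖
        ≤ ∏ i : Fin n, if i ∈ B then Q else Real.exp (-c * t ^ 2) := by
          refine Finset.prod_le_prod (fun i _ => norm_nonneg _) fun i _ => ?_
          split_ifs
          · exact norm_charSum_le hAs hA0 t
          · exact hφ t htd
      _ = Q ^ B.card * Real.exp (-c * t ^ 2) ^ (n - B.card) := by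
          rw [Finset.prod_ite, Finset.prod_const, Finset.prod_const]
          congr 2
          · congr 1; ext i; simp
          · rw [Finset.filter_not, Finset.card_sdiff]; simp
      _ ≤ Q ^ B.card * Real.exp (-(c * n / 2) * t ^ 2) := by
          gcongr
          rw [← Real.exp_nat_mul]
          apply Real.exp_le_exp.2
          have : (n : ℝ) / 2 ≤ ((n - B.card : ℕ) : ℝ) := by
            rw [Nat.cast_sub (by omega)]
            have : (2 : ℝ) * B.card ≤ n := by exact_mod_cast hB
            linarith
          nlinarith [mul_le_mul_of_nonneg_right this (by positivity : 0 ≤ c * t ^ 2)]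
  have hcn : 0 < c * n / 2 := by positivity
  have hint : Integrable fun t : ℝ => Q ^ B.card * Real.exp (-(c * n / 2) * t ^ 2) :=
    (integrable_exp_neg_mul_sq hcn).const_mul _
  have hle : -(Real.pi / d) ≤ Real.pi / d := by
    have : 0 < Real.pi / d := by positivity
    linarith
  have h1 : ‖∫ t in -(Real.pi / d)..(Real.pi / d),
      (∏ i : Fin n, charSum (if i ∈ B then A.indicator p else p) t) *
        Complex.exp ((-(m * t) : ℝ) * Complex.I)‖ ≤ Q ^ B.card * √(Real.pi / (c * n / 2)) := by
    rw [intervalIntegral.integral_of_le hle]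
    calc _ ≤ ∫ t in Set.Ioc (-(Real.pi / d)) (Real.pi / d),
          Q ^ B.card * Real.exp (-(c * n / 2) * t ^ 2) :=
          norm_integral_le_of_norm_le hint.integrableOn
            ((ae_restrict_iff' measurableSet_Ioc).2 (Eventually.of_forall hpt))
      _ ≤ ∫ t : ℝ, Q ^ B.card * Real.exp (-(c * n / 2) * t ^ 2) :=
          setIntegral_le_integral hint (Eventually.of_forall fun t => by positivity)
      _ = _ := by rw [integral_const_mul, integral_gaussian]
  rw [hF, norm_mul, Complex.norm_real, Complex.norm_real, Real.norm_of_nonneg hS0,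
    Real.norm_of_nonneg (by positivity)] at h1
  have e : √(Real.pi / (c * n / 2)) = √(2 * Real.pi / c) / √n := by
    rw [← Real.sqrt_div (by positivity)]; congr 1; field_simp
  rw [e] at h1
  have : S = d / (2 * Real.pi) * (2 * Real.pi / d * S) := by field_simp
  rw [this]
  calc _ ≤ d / (2 * Real.pi) * (Q ^ B.card * (√(2 * Real.pi / c) / √n)) := by gcongr
    _ = _ := by ring

/-- `log(1 + g) = g + O(g^2)`, and `n g^2 → 0` because `n g` converges and `g → 0`. -/
theorem tendsto_one_add_pow_exp {ι : Type*} {l : Filter ι} {n : ι → ℕ} (hn : Tendsto n l atTop)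
    {g : ι → ℂ} {t : ℂ} (hg : Tendsto (fun i => (n i : ℂ) * g i) l (𝓝 t)) :
    Tendsto (fun i => (1 + g i) ^ n i) l (𝓝 (Complex.exp t)) := by
  have hn' : Tendsto (fun i => ((n i : ℂ))⁻¹) l (𝓝 0) :=
    (tendsto_inv_atTop_nhds_zero_nat (𝕜 := ℂ)).comp hn
  have hn0 : ∀ᶠ i in l, (n i : ℂ) ≠ 0 :=
    (hn.eventually_gt_atTop 0).mono fun i h => by exact_mod_cast h.ne'
  have hg0 : Tendsto g l (𝓝 0) := by
    have := hn'.mul hg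
    rw [zero_mul] at this
    refine this.congr' (hn0.mono fun i h => ?_)
    field_simp
  have hO : (fun i => (n i : ℂ) * (Complex.log (1 + g i) - g i)) =O[l]
      fun i => (n i : ℂ) * g i ^ 2 :=
    (Asymptotics.isBigO_refl _ _).mul (Complex.log_sub_self_isBigO.comp_tendsto hg0)
  have h0 : Tendsto (fun i => (n i : ℂ) * g i ^ 2) l (𝓝 0) := by
    have := hg.mul hg0
    rw [mul_zero] at this
    refine this.congr fun i => by ring
  have h1 := (hO.trans_tendsto h0).add hg
  rw [zero_add] at h1
  have h2 : Tendsto (fun i => (n i : ℂ) * Complex.log (1 + g i)) l (𝓝 t) :=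
    h1.congr fun i => by ring
  refine ((Complex.continuous_exp.tendsto _).comp h2).congr' ?_
  filter_upwards [hg0.eventually_ne (show (0 : ℂ) ≠ -1 by simp)] with i hi
  have : 1 + g i ≠ 0 := fun h => hi (by linear_combination h)
  simp only [Function.comp]
  rw [Complex.exp_nat_mul, Complex.exp_log this]

/-- The remainder `e^{iu} - 1 - iu`. -/
noncomputable def expRem (u : ℝ) : ℂ :=
  Complex.exp ((u : ℝ) * Complex.I) - 1 - (u : ℝ) * Complex.I

/-- Unlike the Taylor estimate `norm_expRem_add_le`, this holds for all `u`, which is what the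
dominating series in `tendsto_mul_sum_expRem` needs. -/
theorem norm_expRem_le (u : ℝ) : ‖expRem u‖ ≤ 3 * u ^ 2 := by
  have hu : ‖((u : ℝ) : ℂ) * Complex.I‖ = |u| := by simp
  rw [← sq_abs]
  rcases le_or_gt |u| 1 with h | h
  · have := Complex.norm_exp_sub_one_sub_id_le (x := (u : ℝ) * Complex.I) (by rwa [hu])
    rw [hu] at this
    rw [expRem]; nlinarith [sq_nonneg |u|]
  · have h1 : ‖expRem u‖ ≤ 1 + 1 + |u| := by
      rw [expRem]
      refine (norm_sub_le _ _).trans ?_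
      rw [hu]
      gcongr
      refine (norm_sub_le _ _).trans ?_
      rw [Complex.norm_exp_ofReal_mul_I, norm_one]
    nlinarith

theorem norm_expRem_add_le {u : ℝ} (hu1 : |u| ≤ 1) : ‖expRem u + ((u ^ 2 / 2 : ℝ) : ℂ)‖ ≤ |u| ^ 3 := by
  have hu : ‖((u : ℝ) : ℂ) * Complex.I‖ = |u| := by simp
  have := Complex.exp_bound (x := (u : ℝ) * Complex.I) (by rwa [hu]) (n := 3) (by norm_num)
  rw [hu] at this
  have e : expRem u + ((u ^ 2 / 2 : ℝ) : ℂ) = Complex.exp ((u : ℝ) * Complex.I) -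
      ∑ m ∈ Finset.range 3, ((u : ℝ) * Complex.I : ℂ) ^ m / (m.factorial : ℂ) := by
    simp only [expRem, Finset.sum_range_succ, Finset.sum_range_zero, Nat.factorial]
    push_cast
    linear_combination ((u : ℂ) ^ 2 / 2) * Complex.I_sq
  rw [e]
  refine this.trans ?_
  have : 0 ≤ |u| ^ 3 := by positivity
  norm_num [Nat.factorial]
  nlinarith

theorem tendsto_mul_expRem {ι : Type*} {l : Filter ι} {n : ι → ℕ} (hn : Tendsto n l atTop)
    {x : ι → ℝ} {a : ℝ} (hx : Tendsto x l (𝓝 a)) :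
    Tendsto (fun i => (n i : ℂ) * expRem (x i / √(n i))) l (𝓝 ((-(a ^ 2 / 2) : ℝ) : ℂ)) := by
  have hs : Tendsto (fun i => √(n i : ℝ)) l atTop :=
    Real.tendsto_sqrt_atTop.comp (tendsto_natCast_atTop_atTop.comp hn)
  have h1 : Tendsto (fun i => ((-(x i ^ 2 / 2) : ℝ) : ℂ)) l (𝓝 ((-(a ^ 2 / 2) : ℝ) : ℂ)) :=
    (Complex.continuous_ofReal.tendsto _).comp (((hx.pow 2).div_const 2).neg)
  have h2 : Tendsto (fun i => |x i| ^ 3 / √(n i : ℝ)) l (𝓝 0) := (hx.abs.pow 3).div_atTop hs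
  have h4 : Tendsto (fun i => |x i / √(n i : ℝ)|) l (𝓝 0) := by
    simpa using (hx.div_atTop hs).abs
  have h3 : Tendsto (fun i => (n i : ℂ) * expRem (x i / √(n i)) - ((-(x i ^ 2 / 2) : ℝ) : ℂ)) l
      (𝓝 0) := by
    refine squeeze_zero_norm' ?_ h2
    filter_upwards [hn.eventually_gt_atTop 0, h4.eventually (gt_mem_nhds one_pos)] with i hi hi1
    have hn0 : (0 : ℝ) < n i := by exact_mod_cast hi
    have hsq : √(n i : ℝ) ^ 2 = n i := Real.sq_sqrt hn0.le
    have hsp : 0 < √(n i : ℝ) := Real.sqrt_pos.2 hn0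
    have e : (n i : ℂ) * expRem (x i / √(n i)) - ((-(x i ^ 2 / 2) : ℝ) : ℂ)
        = ((n i : ℝ) : ℂ) * (expRem (x i / √(n i)) + (((x i / √(n i)) ^ 2 / 2 : ℝ) : ℂ)) := by
      have : (-(x i ^ 2 / 2) : ℝ) = - (n i * ((x i / √(n i)) ^ 2 / 2)) := by
        rw [div_pow, hsq]; field_simp
      rw [this]; push_cast; ring
    rw [e, norm_mul, Complex.norm_real, Real.norm_of_nonneg hn0.le]
    calc (n i : ℝ) * _ ≤ (n i : ℝ) * |x i / √(n i)| ^ 3 := by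
          gcongr; exact norm_expRem_add_le hi1.le
      _ = |x i| ^ 3 / √(n i) := by
          rw [abs_div, abs_of_pos hsp, div_pow]
          nth_rewrite 1 [← hsq]
          field_simp
  have := h3.add h1
  rw [zero_add] at this
  exact this.congr fun i => by ring

/-! ### Exponential tilting and the local limit theorem -/

/-- The exponentially tilted probability weights `w_k t^k / Φ(t)`. -/
noncomputable def tilt (w : ℕ → ℝ≥0) (t : ℝ) (k : ℕ) : ℝ := (w k : ℝ) * t ^ k / realGen w t

theorem tilt_nonneg {t : ℝ} (ht : 0 ≤ t) (k : ℕ) : 0 ≤ tilt w t k :=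
  div_nonneg (by positivity) (tsum_nonneg fun k => by positivity)

theorem hasSum_tilt (hw0 : 0 < w 0) {t : ℝ} (ht : 0 ≤ t) (hρ : ENNReal.ofReal t < rho w) :
    HasSum (tilt w t) 1 := by
  have := (hasSum_realGen ht hρ).div_const (realGen w t)
  rwa [div_self (realGen_pos hw0 ht hρ).ne'] at this

theorem hasSum_mul_tilt {t : ℝ} (ht : 0 ≤ t) (hρ : ENNReal.ofReal t < rho w) :
    HasSum (fun k : ℕ => (k : ℝ) * tilt w t k) (realPsi w t) := by
  have := (hasSum_realNum ht hρ).div_const (realGen w t)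
  simp only [tilt]
  exact this.congr_fun fun k => by ring

theorem tilt_le (hw0 : 0 < w 0) {t R : ℝ} (ht : 0 ≤ t) (htR : t ≤ R)
    (hρ : ENNReal.ofReal R < rho w) (k : ℕ) : tilt w t k ≤ (w k : ℝ) * R ^ k / w 0 := by
  have h0 : (0 : ℝ) < w 0 := hw0
  have := le_realGen ht (ofReal_lt_rho_mono htR hρ)
  have hR := ht.trans htR
  unfold tilt
  gcongr

theorem continuousOn_realGen {r : ℝ} (hr : 0 ≤ r) (hρ : ENNReal.ofReal r < rho w) :
    ContinuousOn (realGen w) (Set.Icc 0 r) := by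
  refine continuousOn_tsum (fun k => by fun_prop) (summable_weight hr hρ) ?_
  rintro k x ⟨hx0, hxr⟩
  rw [Real.norm_of_nonneg (by positivity)]; gcongr

theorem tendsto_realGen {ι : Type*} {l : Filter ι} {T : ι → ℝ} {τ R : ℝ}
    (hτ : 0 < τ) (hR : τ < R) (hρ : ENNReal.ofReal R < rho w) (hT : Tendsto T l (𝓝 τ)) :
    Tendsto (fun i => realGen w (T i)) l (𝓝 (realGen w τ)) :=
  (((continuousOn_realGen (hτ.le.trans hR.le) hρ).continuousAt (Icc_mem_nhds hτ hR)).tendsto).comp hT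

theorem tendsto_tilt (hw0 : 0 < w 0) {ι : Type*} {l : Filter ι} {T : ι → ℝ} {τ R : ℝ}
    (hτ : 0 < τ) (hR : τ < R) (hρ : ENNReal.ofReal R < rho w) (hT : Tendsto T l (𝓝 τ)) (k : ℕ) :
    Tendsto (fun i => tilt w (T i) k) l (𝓝 (tilt w τ k)) :=
  ((hT.pow k).const_mul _).div (tendsto_realGen hτ hR hρ hT)
    (realGen_pos hw0 hτ.le (ofReal_lt_rho_mono hR.le hρ)).ne'

/-- The variance of the tilted distribution. -/
noncomputable def tiltVar (w : ℕ → ℝ≥0) (t : ℝ) : ℝ :=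
  ∑' k : ℕ, tilt w t k * ((k : ℝ) - realPsi w t) ^ 2

/-- Dominated convergence for series. Since eventually `T i < R` and `Φ(T i) ≥ w_0`, one series at
the fixed point `R < ρ`, with finite second moment, dominates for all large `i`. -/
theorem tendsto_mul_sum_expRem (hw0 : 0 < w 0) {ι : Type*} {l : Filter ι}
    {T : ι → ℝ} {τ R : ℝ} (hτ : 0 < τ) (hR : τ < R) (hρ : ENNReal.ofReal R < rho w)
    (hT : Tendsto T l (𝓝 τ)) {n : ι → ℕ} (hn : Tendsto n l atTop) {x : ι → ℝ}
    (hx : Tendsto x l (𝓝 (realPsi w τ))) (s : ℝ) :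
    Tendsto (fun i => ∑' k : ℕ, (tilt w (T i) k : ℂ) *
      ((n i : ℂ) * expRem (((k : ℝ) - x i) * s / √(n i)))) l
      (𝓝 ((-(tiltVar w τ * s ^ 2 / 2) : ℝ) : ℂ)) := by
  have hR0 : 0 < R := hτ.trans hR
  have h0 : (0 : ℝ) < w 0 := hw0
  obtain ⟨M, hM⟩ : ∃ M, ∀ᶠ i in l, |x i| ≤ M :=
    ⟨|realPsi w τ| + 1, (hx.abs.eventually (gt_mem_nhds (lt_add_one _))).mono fun i h => h.le⟩
  have hlim : ((-(tiltVar w τ * s ^ 2 / 2) : ℝ) : ℂ) = ∑' k : ℕ, (tilt w τ k : ℂ) *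
      ((-((((k : ℝ) - realPsi w τ) * s) ^ 2 / 2) : ℝ) : ℂ) := by
    rw [tiltVar, mul_div_assoc, ← neg_mul, ← tsum_neg, ← tsum_mul_right, Complex.ofReal_tsum]
    refine tsum_congr fun k => ?_
    push_cast; ring
  rw [hlim]
  refine tendsto_tsum_of_dominated_convergence
    (bound := fun k : ℕ => 6 * s ^ 2 / w 0 *
      ((k : ℝ) ^ 2 * ((w k : ℝ) * R ^ k) + M ^ 2 * ((w k : ℝ) * R ^ k))) ?_ ?_ ?_
  · exact ((summable_pow_mul_weight hR0.le hρ 2).add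
      ((summable_weight hR0.le hρ).mul_left _)).mul_left _
  · intro k
    refine Tendsto.mul ((Complex.continuous_ofReal.tendsto _).comp
      (tendsto_tilt hw0 hτ hR hρ hT k)) ?_
    exact tendsto_mul_expRem hn ((tendsto_const_nhds.sub hx).mul_const s)
  · filter_upwards [hM, hT.eventually (lt_mem_nhds hτ), hT.eventually (gt_mem_nhds hR),
      hn.eventually_gt_atTop 0] with i hMi hTi hTR hni k
    have hn0 : (0 : ℝ) < n i := by exact_mod_cast hni
    rw [norm_mul, norm_mul, Complex.norm_real, Complex.norm_natCast,
      Real.norm_of_nonneg (tilt_nonneg hTi.le k)]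
    have h1 := norm_expRem_le (((k : ℝ) - x i) * s / √(n i))
    have h2 : (n i : ℝ) * ‖expRem (((k : ℝ) - x i) * s / √(n i))‖
        ≤ 6 * s ^ 2 * ((k : ℝ) ^ 2 + M ^ 2) := by
      calc _ ≤ (n i : ℝ) * (3 * (((k : ℝ) - x i) * s / √(n i)) ^ 2) := by gcongr
        _ = 3 * s ^ 2 * ((k : ℝ) - x i) ^ 2 := by
          rw [div_pow, Real.sq_sqrt hn0.le]; field_simp
        _ ≤ 3 * s ^ 2 * (2 * ((k : ℝ) ^ 2 + M ^ 2)) := by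
          gcongr
          have : x i ^ 2 ≤ M ^ 2 := sq_le_sq' (by linarith [(abs_le.1 hMi).1]) (abs_le.1 hMi).2
          nlinarith [sq_nonneg ((k : ℝ) + x i)]
        _ = _ := by ring
    calc _ ≤ (w k : ℝ) * R ^ k / w 0 * (6 * s ^ 2 * ((k : ℝ) ^ 2 + M ^ 2)) :=
          mul_le_mul (tilt_le hw0 hTi.le hTR.le hρ k) h2 (by positivity) (by positivity)
      _ = _ := by ring

/-- Centring at the exact mean cancels the linear term. This is why the tilt varies with `i`: at the
fixed point `τ` the error `m/n - λ` need not be `O(n^(-1/2))`. -/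
theorem charSum_mul_exp_eq {p : ℕ → ℝ} {μ : ℝ} (h0 : ∀ k, 0 ≤ p k) (hp : HasSum p 1)
    (hpμ : HasSum (fun k : ℕ => (k : ℝ) * p k) μ) (t : ℝ) :
    charSum p t * Complex.exp ((-(μ * t) : ℝ) * Complex.I) =
      1 + ∑' k : ℕ, (p k : ℂ) * expRem (((k : ℝ) - μ) * t) := by
  have h1 : HasSum (fun k : ℕ => (p k : ℂ)) 1 := by
    rw [← Complex.ofReal_one]; exact Complex.hasSum_ofReal.2 hp
  have h2 : HasSum (fun k : ℕ => (k : ℂ) * (p k : ℂ)) μ := by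
    exact_mod_cast Complex.hasSum_ofReal.2 hpμ
  have h3 : HasSum (fun k : ℕ => (p k : ℂ) * Complex.exp (((k : ℝ) * t : ℝ) * Complex.I) *
      Complex.exp ((-(μ * t) : ℝ) * Complex.I)) (charSum p t * Complex.exp ((-(μ * t) : ℝ) * Complex.I)) :=
    (summable_charSum hp.summable h0 t).hasSum.mul_right _
  have h4 := (h3.sub h1).sub (((h2.sub (h1.mul_left (μ : ℂ))).mul_right ((t : ℂ) * Complex.I)))
  have h5 : HasSum (fun k : ℕ => (p k : ℂ) * expRem (((k : ℝ) - μ) * t))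
      (charSum p t * Complex.exp ((-(μ * t) : ℝ) * Complex.I) - 1 -
        (μ - μ * 1) * ((t : ℂ) * Complex.I)) := by
    refine h4.congr_fun ?_
    intro k
    rw [mul_assoc, ← Complex.exp_add, expRem]
    have : (((k : ℝ) * t : ℝ) : ℂ) * Complex.I + ((-(μ * t) : ℝ) : ℂ) * Complex.I
        = (((k - μ) * t : ℝ) : ℂ) * Complex.I := by push_cast; ring
    rw [this]; push_cast; ring
  rw [h5.tsum_eq]; ring

theorem tiltVar_pos (hw0 : 0 < w 0) (hw : ∃ k, 1 ≤ k ∧ 0 < w k) {τ : ℝ} (hτ : 0 < τ)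
    (hρ : ENNReal.ofReal τ < rho w) : 0 < tiltVar w τ := by
  have h0 : (0 : ℝ) < w 0 := hw0
  have hG := realGen_pos hw0 hτ.le hρ
  have hs : Summable fun k : ℕ => tilt w τ k * ((k : ℝ) - realPsi w τ) ^ 2 := by
    have h2 := (summable_pow_mul_weight hτ.le hρ 2).div_const (realGen w τ)
    have h1 := (hasSum_mul_tilt hτ.le hρ).summable.mul_left (2 * realPsi w τ)
    have h3 := (hasSum_tilt hw0 hτ.le hρ).summable.mul_left (realPsi w τ ^ 2)
    refine ((h2.sub h1).add h3).congr fun k => ?_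
    rw [tilt]; ring
  refine hs.tsum_pos (fun k => mul_nonneg (tilt_nonneg hτ.le k) (sq_nonneg _)) 0 ?_
  have := realPsi_pos hw0 hw hτ hρ
  have : 0 < tilt w τ 0 := by rw [tilt]; simp only [pow_zero, mul_one]; positivity
  simp only [Nat.cast_zero, zero_sub, neg_sq]
  positivity

/-- The local limit theorem for the tilted distributions. -/
theorem tendsto_sqrt_mul_sum (hw0 : 0 < w 0) (hw : ∃ k, 1 ≤ k ∧ 0 < w k) {T : ℕ → ℝ} {τ R : ℝ}
    (hτ : 0 < τ) (hR : τ < R) (hρ : ENNReal.ofReal R < rho w) (hT : Tendsto T atTop (𝓝 τ))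
    {m n : ℕ → ℕ} (hn : Tendsto n atTop atTop)
    (hTx : ∀ᶠ i in atTop, realPsi w (T i) = m i / n i)
    (hx : Tendsto (fun i => (m i : ℝ) / n i) atTop (𝓝 (realPsi w τ)))
    {d : ℕ} (hd : 0 < d) (hdm : ∀ i, d ∣ m i) (hdw : ∀ k, w k ≠ 0 → d ∣ k)
    {c : ℝ} (hc : 0 < c)
    (hφ : ∀ᶠ i in atTop, ∀ t : ℝ, |t| ≤ Real.pi / d →
      ‖charSum (tilt w (T i)) t‖ ≤ Real.exp (-c * t ^ 2)) :
    Tendsto (fun i => √(n i) * ∑ y ∈ allocations (m i) (n i), ∏ j, tilt w (T i) (y j)) atTop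
      (𝓝 (d / (2 * Real.pi) * √(Real.pi / (tiltVar w τ / 2)))) := by
  have hπ := Real.pi_pos
  have hd0 : (0 : ℝ) < d := by exact_mod_cast hd
  have hv := tiltVar_pos hw0 hw hτ (ofReal_lt_rho_mono hR.le hρ)
  have hgood : ∀ᶠ i in atTop, 0 < T i ∧ T i < R ∧ 0 < n i := by
    filter_upwards [hT.eventually (lt_mem_nhds hτ), hT.eventually (gt_mem_nhds hR),
      hn.eventually_gt_atTop 0] with i h1 h2 h3 using ⟨h1, h2, h3⟩
  have hsn : Tendsto (fun i => √(n i : ℝ)) atTop atTop :=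
    Real.tendsto_sqrt_atTop.comp (tendsto_natCast_atTop_atTop.comp hn)
  let f : ℕ → ℝ → ℂ := fun i t => (charSum (tilt w (T i)) t) ^ n i *
    Complex.exp ((-(m i * t) : ℝ) * Complex.I)
  -- The substitution `t = s/√n` puts the integrand on the whole line, where `exp(-c s^2)` dominates
  -- it.
  let G : ℕ → ℝ → ℂ := fun i => (Set.Ioc (-(√(n i) * (Real.pi / d))) (√(n i) * (Real.pi / d))).indicator
    fun s => f i (s / √(n i))
  have hint : Tendsto (fun i => ∫ s, G i s) atTop
      (𝓝 (∫ s : ℝ, ((Real.exp (-(tiltVar w τ / 2) * s ^ 2) : ℝ) : ℂ))) := by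
    refine tendsto_integral_filter_of_dominated_convergence (fun s => Real.exp (-c * s ^ 2)) ?_ ?_
      (integrable_exp_neg_mul_sq hc) ?_
    · filter_upwards [hgood] with i hi
      refine (Continuous.aestronglyMeasurable ?_).indicator measurableSet_Ioc
      have := continuous_charSum (hasSum_tilt hw0 hi.1.le (ofReal_lt_rho_mono hi.2.1.le hρ)).summable
        (tilt_nonneg hi.1.le)
      fun_prop
    · filter_upwards [hgood, hφ] with i hi hφi
      refine Eventually.of_forall fun s => ?_
      have hn0 : (0 : ℝ) < n i := by exact_mod_cast hi.2.2
      have hsp : 0 < √(n i : ℝ) := Real.sqrt_pos.2 hn0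
      simp only [G, Set.indicator_apply]
      split_ifs with hs
      · have hsd : |s / √(n i)| ≤ Real.pi / d := by
          rw [abs_div, abs_of_pos hsp, div_le_iff₀ hsp, mul_comm]
          exact abs_le.2 ⟨hs.1.le, hs.2⟩
        simp only [f]
        rw [norm_mul, Complex.norm_exp_ofReal_mul_I, mul_one, norm_pow]
        calc _ ≤ Real.exp (-c * (s / √(n i)) ^ 2) ^ n i := by gcongr; exact hφi _ hsd
          _ = _ := by
            rw [← Real.exp_nat_mul, div_pow, Real.sq_sqrt hn0.le]; congr 1; field_simp
      · rw [norm_zero]; positivity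
    · refine Eventually.of_forall fun s => ?_
      have hsum := tendsto_mul_sum_expRem hw0 hτ hR hρ hT hn hx s
      have hg : Tendsto (fun i => (n i : ℂ) * ∑' k : ℕ, (tilt w (T i) k : ℂ) *
          expRem (((k : ℝ) - m i / n i) * (s / √(n i)))) atTop
          (𝓝 ((-(tiltVar w τ * s ^ 2 / 2) : ℝ) : ℂ)) := by
        refine hsum.congr fun i => ?_
        rw [← tsum_mul_left]
        refine tsum_congr fun k => ?_
        rw [mul_div_assoc]; ring
      have hpow := tendsto_one_add_pow_exp hn hg
      rw [← Complex.ofReal_exp] at hpow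
      have e : -(tiltVar w τ * s ^ 2 / 2) = -(tiltVar w τ / 2) * s ^ 2 := by ring
      rw [e] at hpow
      refine hpow.congr' ?_
      have hmem : ∀ᶠ i in atTop,
          s ∈ Set.Ioc (-(√(n i : ℝ) * (Real.pi / d))) (√(n i : ℝ) * (Real.pi / d)) := by
        have := (hsn.atTop_mul_const (show 0 < Real.pi / d by positivity)).eventually_gt_atTop |s|
        filter_upwards [this] with i hi
        exact ⟨(abs_lt.1 hi).1, (abs_lt.1 hi).2.le⟩
      filter_upwards [hgood, hmem, hTx] with i hi hmi hTi
      have hiρ := ofReal_lt_rho_mono hi.2.1.le hρ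
      have hn0 : (n i : ℝ) ≠ 0 := by exact_mod_cast hi.2.2.ne'
      have hmean := hasSum_mul_tilt (w := w) hi.1.le hiρ
      rw [hTi] at hmean
      rw [← charSum_mul_exp_eq (tilt_nonneg hi.1.le) (hasSum_tilt hw0 hi.1.le hiρ) hmean]
      simp only [G, Set.indicator_of_mem hmi, f]
      rw [mul_pow, ← Complex.exp_nat_mul]
      congr 2
      rw [← mul_assoc]
      congr 1
      have : (-(m i * (s / √(n i))) : ℝ) = n i * -(m i / n i * (s / √(n i))) := by
        field_simp
      rw [this]; push_cast; ring
  rw [integral_complex_ofReal, integral_gaussian] at hint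
  have hfin : ∀ᶠ i in atTop, ((√(n i) * ∑ y ∈ allocations (m i) (n i), ∏ j, tilt w (T i) (y j) : ℝ) : ℂ)
      = ((d / (2 * Real.pi) : ℝ) : ℂ) * ∫ s, G i s := by
    filter_upwards [hgood] with i hi
    have hn0 : (0 : ℝ) < n i := by exact_mod_cast hi.2.2
    have hsp : 0 < √(n i : ℝ) := Real.sqrt_pos.2 hn0
    have hF := integral_prod_charSum hd (hdm i) (fun _ : Fin (n i) => tilt w (T i))
      (fun _ => tilt_nonneg hi.1.le)
      (fun _ => (hasSum_tilt hw0 hi.1.le (ofReal_lt_rho_mono hi.2.1.le hρ)).summable)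
      (fun _ k hk => hdw k fun h => hk (by simp [tilt, h]))
    simp only [Finset.prod_const, Finset.card_univ, Fintype.card_fin] at hF
    have hle : -(√(n i) * (Real.pi / d)) ≤ √(n i) * (Real.pi / d) := by
      have : 0 < √(n i) * (Real.pi / d) := by positivity
      linarith
    rw [integral_indicator measurableSet_Ioc, ← intervalIntegral.integral_of_le hle,
      intervalIntegral.integral_comp_div (f i) hsp.ne', neg_div, mul_div_cancel_left₀ _ hsp.ne', hF,
      Complex.real_smul]
    push_cast
    have h1 : (d : ℂ) ≠ 0 := by exact_mod_cast hd.ne'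
    have h2 : (Real.pi : ℂ) ≠ 0 := by exact_mod_cast hπ.ne'
    field_simp
  have h1 := (hint.const_mul ((d / (2 * Real.pi) : ℝ) : ℂ)).congr' (hfin.mono fun i h => h.symm)
  rw [← Complex.ofReal_mul] at h1
  exact (Complex.continuous_re.tendsto _).comp h1

/-! ### Comparison of the random allocation with independent variables -/

/-- The tilting factor depends only on `m` and `n`, so it cancels in the conditional law. -/
theorem prod_tilt {m n : ℕ} {t : ℝ} {y : Fin n → ℕ} (hy : y ∈ allocations m n) :
    ∏ i, tilt w t (y i) = (weight w y : ℝ) * (t ^ m / realGen w t ^ n) := by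
  rw [mem_allocations] at hy
  simp only [tilt, Finset.prod_div_distrib, Finset.prod_mul_distrib, Finset.prod_pow_eq_pow_sum, hy,
    Finset.prod_const, Finset.card_univ, Fintype.card_fin, weight]
  push_cast; ring

theorem dvd_of_partitionFun_pos {d m n : ℕ} (hdw : ∀ k, w k ≠ 0 → d ∣ k)
    (hZ : 0 < partitionFun w m n) : d ∣ m := by
  obtain ⟨y, hy, hy0⟩ := Finset.exists_ne_zero_of_sum_ne_zero hZ.ne'
  rw [mem_allocations] at hy
  rw [← hy]
  exact Finset.dvd_sum fun i hi => hdw _ (Finset.prod_ne_zero_iff.1 hy0 i hi)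

theorem allocLaw_apply (m n : ℕ) (E : Set (Fin n → ℕ)) [DecidablePred (· ∈ E)] :
    allocLaw w m n E = ∑ y ∈ allocations m n,
      if y ∈ E then ((weight w y / partitionFun w m n : ℝ≥0) : ℝ≥0∞) else 0 := by
  simp only [allocLaw, Measure.coe_finsetSum, Finset.sum_apply, Measure.smul_apply, smul_eq_mul,
    Measure.dirac_apply, Set.indicator_apply, Pi.one_apply, mul_ite, mul_one, mul_zero]

theorem allocLaw_le_of_tilt {m n : ℕ} (hZ : 0 < partitionFun w m n) {t : ℝ} (ht : 0 < t)
    (hG : 0 < realGen w t) (B : Finset (Fin n)) (A : Set ℕ) {K : ℝ}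
    (h : ∑ y ∈ allocations m n, ∏ i, (if i ∈ B then A.indicator (tilt w t) else tilt w t) (y i) ≤
      K * ∑ y ∈ allocations m n, ∏ i, tilt w t (y i)) :
    allocLaw w m n {y | ∀ i ∈ B, y i ∈ A} ≤ ENNReal.ofReal K := by
  classical
  have hZ' : (0 : ℝ) < partitionFun w m n := hZ
  set a := t ^ m / realGen w t ^ n with ha
  have ha0 : 0 < a := by positivity
  have h2 : ∑ y ∈ allocations m n, ∏ i, tilt w t (y i) = partitionFun w m n * a := by
    rw [partitionFun]; push_cast; rw [Finset.sum_mul]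
    exact Finset.sum_congr rfl fun y hy => prod_tilt hy
  have h1 : ∑ y ∈ allocations m n, (if y ∈ {y : Fin n → ℕ | ∀ i ∈ B, y i ∈ A} then
      (weight w y : ℝ) else 0) * a ≤
      ∑ y ∈ allocations m n, ∏ i, (if i ∈ B then A.indicator (tilt w t) else tilt w t) (y i) := by
    refine Finset.sum_le_sum fun y hy => ?_
    split_ifs with hyE
    · rw [ha, ← prod_tilt hy]
      refine (Finset.prod_congr rfl fun i _ => ?_).le
      split_ifs with hi
      · rw [Set.indicator_of_mem (hyE i hi)]
      · rfl
    · rw [zero_mul]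
      refine Finset.prod_nonneg fun i _ => ?_
      split_ifs
      · exact Set.indicator_nonneg (fun k _ => tilt_nonneg ht.le k) _
      · exact tilt_nonneg ht.le _
  rw [h2, ← mul_assoc] at h
  rw [← Finset.sum_mul] at h1
  have h3 := le_of_mul_le_mul_right (h1.trans h) ha0
  rw [allocLaw_apply]
  have e : ∀ y : Fin n → ℕ, (if y ∈ {y : Fin n → ℕ | ∀ i ∈ B, y i ∈ A} then
      ((weight w y / partitionFun w m n : ℝ≥0) : ℝ≥0∞) else 0) =
      ENNReal.ofReal ((if y ∈ {y : Fin n → ℕ | ∀ i ∈ B, y i ∈ A} then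
        (weight w y : ℝ) else 0) / partitionFun w m n) := by
    intro y
    split_ifs
    · rw [← NNReal.coe_div, ENNReal.ofReal_coe_nnreal]
    · simp
  simp only [e]
  rw [← ENNReal.ofReal_sum_of_nonneg, ← Finset.sum_div]
  · exact ENNReal.ofReal_le_ofReal ((div_le_iff₀ hZ').2 h3)
  · intro y _
    split_ifs <;> positivity

/-- The upper bound of `sum_restricted_le` and the limit in `tendsto_sqrt_mul_sum` are both of order
`n^(-1/2)`; their quotient is free of `n`. -/
theorem exists_allocLaw_le (hw0 : 0 < w 0) (hw : ∃ k, 1 ≤ k ∧ 0 < w k) {T : ℕ → ℝ} {τ R : ℝ}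
    (hτ : 0 < τ) (hR : τ < R) (hρ : ENNReal.ofReal R < rho w) (hT : Tendsto T atTop (𝓝 τ))
    {m n : ℕ → ℕ} (hn : Tendsto n atTop atTop) (hZ : ∀ i, 0 < partitionFun w (m i) (n i))
    (hTx : ∀ᶠ i in atTop, realPsi w (T i) = m i / n i)
    (hx : Tendsto (fun i => (m i : ℝ) / n i) atTop (𝓝 (realPsi w τ))) :
    ∃ C > 0, ∀ᶠ i in atTop, ∀ B : Finset (Fin (n i)), 2 * B.card ≤ n i → ∀ A : Set ℕ,
      allocLaw w (m i) (n i) {y | ∀ j ∈ B, y j ∈ A} ≤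
        ENNReal.ofReal (C * (∑' k, A.indicator (tilt w (T i)) k) ^ B.card) := by
  have hπ := Real.pi_pos
  have hτρ := ofReal_lt_rho_mono hR.le hρ
  obtain ⟨F, hF, hFS, hd, hdw⟩ := exists_finset_gcd_dvd {k | w k ≠ 0}
    (by obtain ⟨k, hk, hwk⟩ := hw; exact ⟨k, hk, hwk.ne'⟩)
  set d := F.gcd id with hdd
  have hd0 : (0 : ℝ) < d := by exact_mod_cast hd
  have hpos : ∀ k, w k ≠ 0 → 0 < tilt w τ k := by
    intro k hk
    have : (0 : ℝ) < w k := NNReal.coe_pos.2 (pos_iff_ne_zero.2 hk)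
    exact div_pos (by positivity) (realGen_pos hw0 hτ.le hτρ)
  -- Half of the minimum at `τ`: the strict inequality then persists for `T i` near `τ`.
  obtain ⟨a, ha, haF⟩ : ∃ a > 0, ∀ k ∈ F, a < tilt w τ 0 * tilt w τ k := by
    obtain ⟨k₁, hk₁, hmin⟩ := F.exists_min_image (fun k => tilt w τ 0 * tilt w τ k) hF
    have h1 : 0 < tilt w τ 0 * tilt w τ k₁ := mul_pos (hpos 0 hw0.ne') (hpos k₁ (hFS k₁ hk₁).2)
    exact ⟨_, half_pos h1, fun k hk => (half_lt_self h1).trans_le (hmin k hk)⟩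
  obtain ⟨c, hc, hcφ⟩ := norm_charSum_le_exp hF (fun k hk => (hFS k hk).1) ha
  have hgood : ∀ᶠ i in atTop, 0 < T i ∧ T i < R ∧ 0 < n i := by
    filter_upwards [hT.eventually (lt_mem_nhds hτ), hT.eventually (gt_mem_nhds hR),
      hn.eventually_gt_atTop 0] with i h1 h2 h3 using ⟨h1, h2, h3⟩
  have hφ : ∀ᶠ i in atTop, ∀ t : ℝ, |t| ≤ Real.pi / d →
      ‖charSum (tilt w (T i)) t‖ ≤ Real.exp (-c * t ^ 2) := by
    have hall : ∀ᶠ i in atTop, ∀ k ∈ F, a < tilt w (T i) 0 * tilt w (T i) k := by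
      rw [Filter.eventually_all_finset]
      intro k hk
      exact ((tendsto_tilt hw0 hτ hR hρ hT 0).mul (tendsto_tilt hw0 hτ hR hρ hT k)).eventually
        (lt_mem_nhds (haF k hk))
    filter_upwards [hgood, hall] with i hi hai
    exact hcφ _ (hasSum_tilt hw0 hi.1.le (ofReal_lt_rho_mono hi.2.1.le hρ)) (tilt_nonneg hi.1.le)
      fun k hk => (hai k hk).le
  have hdm : ∀ i, d ∣ m i := fun i => dvd_of_partitionFun_pos hdw (hZ i)
  have hlim := tendsto_sqrt_mul_sum hw0 hw hτ hR hρ hT hn hTx hx hd hdm hdw hc hφ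
  set L := d / (2 * Real.pi) * √(Real.pi / (tiltVar w τ / 2)) with hL
  have hv := tiltVar_pos hw0 hw hτ hτρ
  have hL0 : 0 < L := by positivity
  refine ⟨d / (2 * Real.pi) * √(2 * Real.pi / c) / (L / 2), by positivity, ?_⟩
  filter_upwards [hgood, hφ, hlim.eventually (lt_mem_nhds (half_lt_self hL0))] with i hi hφi hLi B hB A
  have hiρ := ofReal_lt_rho_mono hi.2.1.le hρ
  refine allocLaw_le_of_tilt (hZ i) hi.1 (realGen_pos hw0 hi.1.le hiρ) B A ?_
  refine (sum_restricted_le hd (hdm i) hi.2.2 (hasSum_tilt hw0 hi.1.le hiρ) (tilt_nonneg hi.1.le)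
    (fun k hk => hdw k fun h => hk (by simp [tilt, h])) hc hφi B hB A).trans ?_
  set S := ∑ y ∈ allocations (m i) (n i), ∏ j, tilt w (T i) (y j)
  set Q := ∑' k, A.indicator (tilt w (T i)) k with hQ
  have hQ0 : 0 ≤ Q := tsum_nonneg fun k => Set.indicator_nonneg (fun k _ => tilt_nonneg hi.1.le k) k
  have hn0 : (0 : ℝ) < n i := by exact_mod_cast hi.2.2
  have hsp : 0 < √(n i : ℝ) := Real.sqrt_pos.2 hn0
  have h1 : 1 / √(n i : ℝ) ≤ S / (L / 2) := by
    rw [div_le_div_iff₀ hsp (by positivity)]; linarith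
  calc _ = d / (2 * Real.pi) * √(2 * Real.pi / c) * Q ^ B.card * (1 / √(n i)) := by ring
    _ ≤ d / (2 * Real.pi) * √(2 * Real.pi / c) * Q ^ B.card * (S / (L / 2)) := by gcongr
    _ = _ := by ring

/-! ### Order statistics -/

/-- A nonzero value cannot be the default of `getD`, so it is a genuine entry. -/
theorem exists_eq_nthLargest {n : ℕ} {y : Fin n → ℕ} {j : ℕ} (h : nthLargest y j ≠ 0) :
    ∃ i, y i = nthLargest y j := by
  set l := (Finset.univ.val.map y).sort (· ≥ ·) with hl
  have hlen : j - 1 < l.length := by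
    by_contra! hle
    exact h (List.getD_eq_default _ _ hle)
  have hmem : nthLargest y j ∈ l := by
    rw [nthLargest, ← hl, List.getD_eq_getElem _ _ hlen]
    exact List.getElem_mem hlen
  rw [hl, Multiset.mem_sort, Multiset.mem_map] at hmem
  obtain ⟨i, -, hi⟩ := hmem
  exact ⟨i, hi⟩

/-- If the entry at index `j - 1` of the decreasing list were below `k`, only the `j - 1` entries
before it could reach `k`. -/
theorem le_nthLargest {n : ℕ} {y : Fin n → ℕ} {j k : ℕ} (hj : 1 ≤ j) (S : Finset (Fin n))
    (hS : j ≤ S.card) (hk : ∀ i ∈ S, k ≤ y i) : k ≤ nthLargest y j := by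
  set l := (Finset.univ.val.map y).sort (· ≥ ·) with hl
  have hsorted : l.Pairwise (· ≥ ·) := Multiset.pairwise_sort _ _
  have hcount : j ≤ l.countP (fun a => k ≤ a) := by
    rw [← Multiset.coe_countP, hl, Multiset.sort_eq, Multiset.countP_map]
    refine hS.trans (Finset.card_le_card (t := Finset.univ.filter fun i => k ≤ y i) fun i hi => ?_)
    simp [hk i hi]
  have hlen : j - 1 < l.length := by
    have := hcount.trans List.countP_le_length
    omega
  rw [nthLargest, ← hl, List.getD_eq_getElem _ _ hlen]
  by_contra! hlt
  have h1 : l.countP (fun a => k ≤ a) ≤ j - 1 := by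
    rw [← List.take_append_drop (j - 1) l, List.countP_append]
    have h2 : (l.drop (j - 1)).countP (fun a => k ≤ a) = 0 := by
      rw [List.countP_eq_zero]
      intro a ha
      obtain ⟨i, hi, rfl⟩ := List.mem_iff_getElem.1 ha
      rw [List.getElem_drop]
      have hi' : j - 1 + i < l.length := by rw [List.length_drop] at hi; omega
      have h3 : l[j - 1 + i] ≤ l[j - 1] := by
        rcases Nat.eq_zero_or_pos i with rfl | hi0
        · simp
        · exact List.pairwise_iff_getElem.1 hsorted _ _ hlen hi' (by omega)
      simp only [decide_eq_true_eq]; omega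
    have h4 : (l.take (j - 1)).countP (fun a => k ≤ a) ≤ j - 1 :=
      List.countP_le_length.trans (by simp)
    omega
  omega

theorem nthLargest_le_first {n : ℕ} (y : Fin n → ℕ) (j : ℕ) : nthLargest y j ≤ nthLargest y 1 := by
  by_cases h : nthLargest y j = 0
  · omega
  · obtain ⟨i, hi⟩ := exists_eq_nthLargest h
    exact le_nthLargest le_rfl {i} (by simp) (by simp [hi])

/-! ### Tails of the tilted distribution -/

theorem div_rpow_log {r t b x : ℝ} (hr : 0 < r) (ht : 0 < t) :
    (t / r) ^ (b * x) = Real.exp (-(b * Real.log (r / t)) * x) := by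
  rw [Real.rpow_def_of_pos (by positivity), Real.log_div ht.ne' hr.ne', Real.log_div hr.ne' ht.ne']
  congr 1; ring

/-- Chernoff's bound: `t^k = r^k (t/r)^k` with `(t/r)^k ≤ (t/r)^x` for `k ≥ x`, while `Φ(t) ≥ w_0`.
-/
theorem tsum_tail_tilt_le (hw0 : 0 < w 0) {t r : ℝ} (ht : 0 < t) (htr : t ≤ r)
    (hρ : ENNReal.ofReal r < rho w) (x : ℝ) :
    ∑' k, {k : ℕ | x ≤ k}.indicator (tilt w t) k ≤ realGen w r / w 0 * (t / r) ^ x := by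
  have hr : 0 < r := ht.trans_le htr
  have h0 : (0 : ℝ) < w 0 := hw0
  have hG := le_realGen ht.le (ofReal_lt_rho_mono htr hρ)
  have hs := ((hasSum_realGen hr.le hρ).div_const (w 0 : ℝ)).mul_right ((t / r) ^ x)
  rw [← hs.tsum_eq]
  refine ((hasSum_tilt hw0 ht.le (ofReal_lt_rho_mono htr hρ)).summable.indicator _).tsum_le_tsum
    (fun k => ?_) hs.summable
  rw [Set.indicator_apply]
  split_ifs with hk
  · have h1 : (t / r) ^ (k : ℝ) ≤ (t / r) ^ x :=
      Real.rpow_le_rpow_of_exponent_ge (by positivity) ((div_le_one hr).2 htr) hk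
    rw [Real.rpow_natCast] at h1
    have h2 : t ^ k = r ^ k * (t / r) ^ k := by rw [div_pow]; field_simp
    rw [tilt, h2]
    calc (w k : ℝ) * (r ^ k * (t / r) ^ k) / realGen w t
        ≤ (w k : ℝ) * (r ^ k * (t / r) ^ x) / w 0 := by gcongr
      _ = _ := by ring
  · positivity

/-- The radius of convergence bounds the weights only from above; the root limit is what gives a
lower bound along all large `k`. -/
theorem eventually_le_weight {r : ℝ} (hr : 0 < r) (hρr : rho w < ENNReal.ofReal r)
    (hlim : Tendsto (fun k : ℕ => (w k : ℝ≥0∞) ^ (1 / (k : ℝ))) atTop (𝓝 (rho w)⁻¹)) :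
    ∀ᶠ k : ℕ in atTop, (1 / r) ^ k ≤ (w k : ℝ) := by
  filter_upwards [hlim.eventually (lt_mem_nhds (ENNReal.inv_lt_inv.2 hρr)),
    eventually_ge_atTop 1] with k hk hk1
  have hk0 : (k : ℝ) ≠ 0 := by positivity
  have h1 := pow_le_pow_left' hk.le k
  rw [← ENNReal.rpow_natCast (_ ^ (1 / (k : ℝ))), ← ENNReal.rpow_mul, one_div_mul_cancel hk0,
    ENNReal.rpow_one, ← ENNReal.ofReal_inv_of_pos hr, ← ENNReal.ofReal_pow (by positivity),
    ← ENNReal.ofReal_coe_nnreal, ENNReal.ofReal_le_ofReal_iff (by positivity)] at h1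
  rwa [one_div]

theorem tsum_indicator_compl_singleton (hw0 : 0 < w 0) {t : ℝ} (ht : 0 ≤ t)
    (hρ : ENNReal.ofReal t < rho w) (k : ℕ) :
    ∑' i, ({k}ᶜ : Set ℕ).indicator (tilt w t) i = 1 - tilt w t k := by
  have h1 : HasSum (({k} : Set ℕ).indicator (tilt w t)) (tilt w t k) := by
    have := hasSum_single (f := ({k} : Set ℕ).indicator (tilt w t)) k
      fun i hi => Set.indicator_of_notMem (by simpa using hi) _
    simpa using this
  rw [Set.indicator_compl]
  exact ((hasSum_tilt hw0 ht hρ).sub h1).tsum_eq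

/-! ### The two tail estimates for the order statistics -/

theorem tendsto_mul_log_div {ι : Type*} {l : Filter ι} {T : ι → ℝ} {τ r b : ℝ} (hτ : 0 < τ)
    (hr : 0 < r) (hT : Tendsto T l (𝓝 τ)) :
    Tendsto (fun i => b * Real.log (r / T i)) l (𝓝 (b * Real.log (r / τ))) :=
  ((tendsto_const_nhds.div hT hτ.ne').log (by positivity)).const_mul _

/-- The bound, for the random allocation, on the probability that prescribed boxes have
contents in a prescribed set, in terms of the tilted distribution. -/
def BlockBound (w : ℕ → ℝ≥0) (m n : ℕ → ℕ) (T : ℕ → ℝ) (C : ℝ) : Prop :=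
  ∀ᶠ i in atTop, ∀ B : Finset (Fin (n i)), 2 * B.card ≤ n i → ∀ A : Set ℕ,
    allocLaw w (m i) (n i) {y | ∀ j ∈ B, y j ∈ A} ≤
      ENNReal.ofReal (C * (∑' k, A.indicator (tilt w (T i)) k) ^ B.card)

/-- A union bound over the boxes: the Chernoff tail at `b log n` is `O(n^(-γ))` with `γ > 1`, and
there are `n` boxes. -/
theorem tendsto_measure_le_first (hw0 : 0 < w 0) {T : ℕ → ℝ} {τ r b C : ℝ} {m n : ℕ → ℕ}
    (hτ : 0 < τ) (hr : τ < r) (hρ : ENNReal.ofReal r < rho w) (hT : Tendsto T atTop (𝓝 τ))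
    (hn : Tendsto n atTop atTop) (hC : 0 < C) (hbd : BlockBound w m n T C)
    (hb : 0 < b) (hb1 : 1 < b * Real.log (r / τ)) :
    Tendsto (fun i => allocLaw w (m i) (n i) {y | b * Real.log (n i) ≤ nthLargest y 1}) atTop
      (𝓝 0) := by
  have hr0 := hτ.trans hr
  have h0 : (0 : ℝ) < w 0 := hw0
  have hGr := realGen_pos hw0 hr0.le hρ
  -- The gap leaves room for replacing `τ` by `T i`.
  obtain ⟨γ, hγ1, hγ⟩ := exists_between hb1
  have hnR : Tendsto (fun i => (n i : ℝ)) atTop atTop := tendsto_natCast_atTop_atTop.comp hn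
  have hlim : Tendsto (fun i => ENNReal.ofReal (C * (realGen w r / w 0) * (n i : ℝ) ^ (-(γ - 1))))
      atTop (𝓝 0) := by
    rw [← ENNReal.ofReal_zero]
    refine ENNReal.tendsto_ofReal ?_
    have := ((tendsto_rpow_neg_atTop (sub_pos.2 hγ1)).comp hnR).const_mul (C * (realGen w r / w 0))
    simpa using this
  refine tendsto_of_tendsto_of_tendsto_of_le_of_le' tendsto_const_nhds hlim
    (Eventually.of_forall fun _ => zero_le) ?_
  filter_upwards [hbd, hT.eventually (lt_mem_nhds hτ), hT.eventually (gt_mem_nhds hr),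
    (tendsto_mul_log_div hτ hr0 hT).eventually (lt_mem_nhds hγ),
    hn.eventually_ge_atTop 2] with i hi hTi hTr hγi hni
  have hn2 : (2 : ℝ) ≤ n i := by exact_mod_cast hni
  have hn0 : (0 : ℝ) < n i := by linarith
  have hlog : 0 < Real.log (n i) := Real.log_pos (by linarith)
  have hx : 0 < b * Real.log (n i) := by positivity
  have hQ : ∑' k, {k : ℕ | b * Real.log (n i) ≤ k}.indicator (tilt w (T i)) k ≤
      realGen w r / w 0 * (n i : ℝ) ^ (-γ) := by
    refine (tsum_tail_tilt_le hw0 hTi hTr.le hρ _).trans ?_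
    rw [div_rpow_log hr0 hTi, Real.rpow_def_of_pos hn0, mul_comm (Real.log _)]
    exact mul_le_mul_of_nonneg_left (Real.exp_le_exp.2
      (mul_le_mul_of_nonneg_right (by linarith) hlog.le)) (by positivity)
  calc allocLaw w (m i) (n i) {y | b * Real.log (n i) ≤ nthLargest y 1}
      ≤ allocLaw w (m i) (n i) (⋃ j : Fin (n i),
          {y | ∀ l ∈ ({j} : Finset (Fin (n i))), y l ∈ {k : ℕ | b * Real.log (n i) ≤ k}}) := by
        refine measure_mono fun y hy => ?_
        have hy' : b * Real.log (n i) ≤ nthLargest y 1 := hy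
        have hne : nthLargest y 1 ≠ 0 := fun h => by
          rw [h, Nat.cast_zero] at hy'; linarith
        obtain ⟨j, hj⟩ := exists_eq_nthLargest hne
        refine Set.mem_iUnion.2 ⟨j, fun l hl => ?_⟩
        rw [Finset.mem_singleton.1 hl, hj]
        exact hy'
    _ ≤ ∑ j : Fin (n i), allocLaw w (m i) (n i)
          {y | ∀ l ∈ ({j} : Finset (Fin (n i))), y l ∈ {k : ℕ | b * Real.log (n i) ≤ k}} :=
        measure_iUnion_fintype_le _ _
    _ ≤ ∑ _j : Fin (n i), ENNReal.ofReal (C * (realGen w r / w 0 * (n i : ℝ) ^ (-γ))) := by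
        refine Finset.sum_le_sum fun j _ => ?_
        refine (hi {j} (by simpa using hni) _).trans (ENNReal.ofReal_le_ofReal ?_)
        rw [Finset.card_singleton, pow_one]
        gcongr
    _ = ENNReal.ofReal (C * (realGen w r / w 0) * (n i : ℝ) ^ (-(γ - 1))) := by
        rw [Finset.sum_const, Finset.card_univ, Fintype.card_fin, nsmul_eq_mul,
          ← ENNReal.ofReal_natCast, ← ENNReal.ofReal_mul hn0.le]
        congr 1
        have : -(γ - 1) = -γ + 1 := by ring
        rw [this, Real.rpow_add_one hn0.ne']
        ring

/-- The `l`-th block of `s` consecutive boxes. -/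
def block (n s l : ℕ) : Finset (Fin n) :=
  Finset.univ.filter fun i => l * s ≤ (i : ℕ) ∧ (i : ℕ) < (l + 1) * s

theorem card_block {n s l : ℕ} (h : (l + 1) * s ≤ n) : (block n s l).card = s := by
  have : (block n s l).map Fin.valEmbedding = Finset.Ico (l * s) ((l + 1) * s) := by
    ext a
    simp only [block, Finset.mem_map, Finset.mem_filter, Finset.mem_univ, true_and,
      Fin.valEmbedding_apply, Finset.mem_Ico]
    constructor
    · rintro ⟨i, hi, rfl⟩; exact hi
    · intro ha; exact ⟨⟨a, by omega⟩, ha, rfl⟩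
  rw [← Finset.card_map Fin.valEmbedding, this, Nat.card_Ico, add_mul, one_mul, Nat.add_sub_cancel_left]

theorem block_index_unique {n s l l' : ℕ} {i : Fin n} (h : i ∈ block n s l) (h' : i ∈ block n s l') :
    l = l' := by
  simp only [block, Finset.mem_filter, Finset.mem_univ, true_and] at h h'
  have h1 := lt_of_mul_lt_mul_right (h.1.trans_lt h'.2) (Nat.zero_le s)
  have h2 := lt_of_mul_lt_mul_right (h'.1.trans_lt h.2) (Nat.zero_le s)
  omega

/-- If each of `j` disjoint blocks contains a box with exactly `K` balls, then `Y_(j) ≥ K`. A block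
of `s` boxes misses `K` with probability at most `C (1 - p_K)^s`, and `s p_K` is at least of order
`n^(1-γ)`. -/
theorem tendsto_measure_nthLargest_le (hw0 : 0 < w 0) {T : ℕ → ℝ} {τ R b C : ℝ} {m n : ℕ → ℕ}
    (hτ : 0 < τ) (hR : τ < R) (hρ : ENNReal.ofReal R < rho w) (hT : Tendsto T atTop (𝓝 τ))
    (hn : Tendsto n atTop atTop) (hC : 0 < C) (hbd : BlockBound w m n T C)
    (hρtop : rho w ≠ ⊤)
    (hlim : Tendsto (fun k : ℕ => (w k : ℝ≥0∞) ^ (1 / (k : ℝ))) atTop (𝓝 (rho w)⁻¹))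
    (hb : 0 < b) (hb1 : b * Real.log ((rho w).toReal / τ) < 1) {j : ℕ} (hj : 1 ≤ j) :
    Tendsto (fun i => allocLaw w (m i) (n i) {y | (nthLargest y j : ℝ) ≤ b * Real.log (n i)}) atTop
      (𝓝 0) := by
  have hR0 := hτ.trans hR
  have hGR := realGen_pos hw0 hR0.le hρ
  have hRρ : R < (rho w).toReal := (ENNReal.ofReal_lt_iff_lt_toReal hR0.le hρtop).1 hρ
  have hρ0 : 0 < (rho w).toReal := hR0.trans hRρ
  obtain ⟨γ, hγ, hγ1⟩ := exists_between hb1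
  obtain ⟨r, hrγ, hr⟩ : ∃ r, b * Real.log (r / τ) < γ ∧ (rho w).toReal < r := by
    have hc : Tendsto (fun r : ℝ => b * Real.log (r / τ)) (𝓝[>] (rho w).toReal)
        (𝓝 (b * Real.log ((rho w).toReal / τ))) := by
      refine Tendsto.mono_left ?_ nhdsWithin_le_nhds
      exact ((tendsto_id.div_const τ).log (div_pos hρ0 hτ).ne').const_mul _
    exact ((hc.eventually (gt_mem_nhds hγ)).and self_mem_nhdsWithin).exists
  have hr0 : 0 < r := hρ0.trans hr
  have hρr : rho w < ENNReal.ofReal r := (ENNReal.lt_ofReal_iff_toReal_lt hρtop).2 hr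
  have hnR : Tendsto (fun i => (n i : ℝ)) atTop atTop := tendsto_natCast_atTop_atTop.comp hn
  have hlog : Tendsto (fun i => Real.log (n i : ℝ)) atTop atTop := Real.tendsto_log_atTop.comp hnR
  -- The `+ 1` makes `K` strictly larger than `b log n`.
  set K : ℕ → ℕ := fun i => ⌊b * Real.log (n i)⌋₊ + 1 with hK
  have hKt : Tendsto K atTop atTop :=
    (tendsto_add_atTop_nat 1).comp (tendsto_nat_floor_atTop.comp (hlog.const_mul_atTop hb))
  have hτr : 0 < τ / 2 / r := by positivity
  -- `τ/2` bounds `T i` from below, one factor `T i / r` pays for rounding up to `K`, and `Φ(R)`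
  -- bounds the normalisation.
  set κ := τ / 2 / r / realGen w R with hκ
  have hκ0 : 0 < κ := by positivity
  have hj0 : (0 : ℝ) < j := by exact_mod_cast hj
  have hdecay : Tendsto (fun i => (j : ℝ≥0∞) *
      ENNReal.ofReal (C * Real.exp (-(κ / (4 * j)) * (n i : ℝ) ^ (1 - γ)))) atTop (𝓝 0) := by
    have h1 : Tendsto (fun i => -(κ / (4 * j)) * (n i : ℝ) ^ (1 - γ)) atTop atBot :=
      ((tendsto_rpow_atTop (sub_pos.2 hγ1)).comp hnR).const_mul_atTop_of_neg
        (neg_neg_of_pos (by positivity))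
    have h2 := (Real.tendsto_exp_atBot.comp h1).const_mul C
    rw [mul_zero] at h2
    have h3 := ENNReal.Tendsto.const_mul (a := (j : ℝ≥0∞)) (ENNReal.tendsto_ofReal h2)
      (Or.inr (ENNReal.natCast_ne_top j))
    simpa using h3
  refine tendsto_of_tendsto_of_tendsto_of_le_of_le' tendsto_const_nhds hdecay
    (Eventually.of_forall fun _ => zero_le) ?_
  filter_upwards [hbd, hT.eventually (lt_mem_nhds (half_lt_self hτ)), hT.eventually (gt_mem_nhds hR),
    (tendsto_mul_log_div hτ hr0 hT).eventually (gt_mem_nhds hrγ),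
    hn.eventually_ge_atTop (4 * j), hKt.eventually (eventually_le_weight hr0 hρr hlim)]
    with i hi hTi hTR hγi hni hwi
  have hTi0 : 0 < T i := (half_pos hτ).trans hTi
  have hTρ := ofReal_lt_rho_mono hTR.le hρ
  have hn4 : (4 : ℝ) * j ≤ n i := by exact_mod_cast hni
  have hn1 : (1 : ℝ) ≤ n i := by
    have : (1 : ℝ) ≤ j := by exact_mod_cast hj
    linarith
  have hn0 : (0 : ℝ) < n i := by linarith
  have hlog0 : 0 ≤ Real.log (n i) := Real.log_nonneg hn1
  have hx0 : 0 ≤ b * Real.log (n i) := by positivity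
  have hTr : T i / r ≤ 1 := (div_le_one hr0).2 (by linarith)
  have hTr0 : 0 < T i / r := by positivity
  have hGT : realGen w (T i) ≤ realGen w R := by
    refine (summable_weight hTi0.le hTρ).tsum_le_tsum (fun k => ?_) (summable_weight hR0.le hρ)
    gcongr
  have hGT0 := realGen_pos hw0 hTi0.le hTρ
  have hp : κ * (n i : ℝ) ^ (-γ) ≤ tilt w (T i) (K i) := by
    have h1 : τ / 2 / r * (n i : ℝ) ^ (-γ) ≤ (w (K i) : ℝ) * T i ^ K i := by
      calc τ / 2 / r * (n i : ℝ) ^ (-γ)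
          ≤ T i / r * (T i / r) ^ (b * Real.log (n i)) := by
            rw [div_rpow_log hr0 hTi0, Real.rpow_def_of_pos hn0, mul_comm (Real.log _)]
            exact mul_le_mul (by gcongr) (Real.exp_le_exp.2
              (mul_le_mul_of_nonneg_right (by linarith) hlog0)) (by positivity) (by positivity)
        _ = (T i / r) ^ (b * Real.log (n i) + 1) := by
            rw [Real.rpow_add_one hTr0.ne', mul_comm]
        _ ≤ (T i / r) ^ ((K i : ℕ) : ℝ) := by
            refine Real.rpow_le_rpow_of_exponent_ge hTr0 hTr ?_
            simp only [hK]
            push_cast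
            linarith [Nat.floor_le hx0]
        _ = (1 / r) ^ K i * T i ^ K i := by
            rw [Real.rpow_natCast, ← mul_pow]; congr 1; ring
        _ ≤ (w (K i) : ℝ) * T i ^ K i := by gcongr
    rw [tilt, hκ, div_mul_eq_mul_div]
    gcongr
  -- With `2j` in the denominator, all `j` blocks fit, and each one has at most half of the boxes,
  -- as `BlockBound` demands.
  set s := n i / (2 * j) with hs
  have hs1 : 2 * j * s ≤ n i := Nat.mul_div_le _ _
  have hs2 : (n i : ℝ) / (4 * j) ≤ s := by
    have h1 : n i < 2 * j * (s + 1) := Nat.lt_mul_div_succ _ (by omega)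
    have h2 : 1 ≤ s := (Nat.one_le_div_iff (by omega)).2 (by omega)
    have h3 : (n i : ℝ) ≤ 2 * j * (s + 1) := by exact_mod_cast h1.le
    have h4 : (1 : ℝ) ≤ s := by exact_mod_cast h2
    rw [div_le_iff₀ (by positivity)]
    nlinarith
  have hblock : ∀ l : Fin j, (block (n i) s l).card = s := fun l => card_block (by
    have h1 : ((l : ℕ) + 1) * s ≤ j * s := Nat.mul_le_mul_right _ l.2
    nlinarith)
  have hQ1 : tilt w (T i) (K i) ≤ 1 :=
    le_hasSum (hasSum_tilt hw0 hTi0.le hTρ) _ fun k _ => tilt_nonneg hTi0.le k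
  calc allocLaw w (m i) (n i) {y | (nthLargest y j : ℝ) ≤ b * Real.log (n i)}
      ≤ allocLaw w (m i) (n i) (⋃ l : Fin j,
          {y | ∀ a ∈ block (n i) s l, y a ∈ ({K i}ᶜ : Set ℕ)}) := by
        refine measure_mono fun y hy => ?_
        have hy' : (nthLargest y j : ℝ) ≤ b * Real.log (n i) := hy
        by_contra hcon
        simp only [Set.mem_iUnion, Set.mem_ofPred_eq, Set.mem_compl_iff, Set.mem_singleton_iff,
          not_exists, not_forall, not_not] at hcon
        choose a ha hay using hcon
        have hinj : Function.Injective a := fun l l' hll => by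
          have h1 := ha l
          rw [hll] at h1
          exact Fin.ext (block_index_unique h1 (ha l'))
        have h1 : K i ≤ nthLargest y j := by
          refine le_nthLargest hj (Finset.univ.map ⟨a, hinj⟩) (by simp) ?_
          intro x hx
          obtain ⟨l, -, rfl⟩ := Finset.mem_map.1 hx
          exact (hay l).ge
        have h2 : b * Real.log (n i) < K i := by
          simp only [hK]; push_cast; exact Nat.lt_floor_add_one _
        have h3 : (K i : ℝ) ≤ nthLargest y j := by exact_mod_cast h1
        linarith
    _ ≤ ∑ l : Fin j, allocLaw w (m i) (n i)
          {y | ∀ a ∈ block (n i) s l, y a ∈ ({K i}ᶜ : Set ℕ)} := measure_iUnion_fintype_le _ _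
    _ ≤ ∑ _l : Fin j, ENNReal.ofReal (C * Real.exp (-(κ / (4 * j)) * (n i : ℝ) ^ (1 - γ))) := by
        refine Finset.sum_le_sum fun l _ => ?_
        refine (hi (block (n i) s l) (by rw [hblock]; nlinarith) _).trans
          (ENNReal.ofReal_le_ofReal ?_)
        rw [hblock, tsum_indicator_compl_singleton hw0 hTi0.le hTρ]
        gcongr
        calc (1 - tilt w (T i) (K i)) ^ s
            ≤ Real.exp (-tilt w (T i) (K i)) ^ s := by
              gcongr
              exact Real.one_sub_le_exp_neg _
          _ = Real.exp (-(s * tilt w (T i) (K i))) := by rw [← Real.exp_nat_mul]; congr 1; ring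
          _ ≤ _ := by
              apply Real.exp_le_exp.2
              rw [neg_mul]
              apply neg_le_neg
              calc κ / (4 * j) * (n i : ℝ) ^ (1 - γ)
                  = (n i : ℝ) / (4 * j) * (κ * (n i : ℝ) ^ (-γ)) := by
                    have : (1 - γ) = -γ + 1 := by ring
                    rw [this, Real.rpow_add_one hn0.ne']; ring
                _ ≤ s * tilt w (T i) (K i) := by gcongr
    _ = _ := by
        rw [Finset.sum_const, Finset.card_univ, Fintype.card_fin, nsmul_eq_mul]

/-! ### The constant `1 / log(ρ/τ)` -/

theorem invLogRatio_nonneg {τ : ℝ} (hτ : 0 < τ) (hρ : ENNReal.ofReal τ < rho w) :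
    0 ≤ invLogRatio (rho w) (ENNReal.ofReal τ) := by
  rw [invLogRatio]
  split_ifs with h
  · exact le_rfl
  · rw [ENNReal.toReal_ofReal hτ.le]
    have := (ENNReal.ofReal_lt_iff_lt_toReal hτ.le h).1 hρ
    exact one_div_nonneg.2 (Real.log_nonneg ((one_le_div hτ).2 this.le))

/-- If `ρ = ∞`, the choice `r = τ exp(2/b)` makes the product equal to `2`. Otherwise the inequality
holds at `ρ` and persists just below it. -/
theorem exists_one_lt_mul_log {τ b : ℝ} (hτ : 0 < τ) (hρ : ENNReal.ofReal τ < rho w)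
    (hb : invLogRatio (rho w) (ENNReal.ofReal τ) < b) :
    ∃ r, τ < r ∧ ENNReal.ofReal r < rho w ∧ 1 < b * Real.log (r / τ) := by
  have hb0 : 0 < b := (invLogRatio_nonneg hτ hρ).trans_lt hb
  rw [invLogRatio] at hb
  split_ifs at hb with h
  · refine ⟨τ * Real.exp (2 / b), ?_, ?_, ?_⟩
    · exact lt_mul_of_one_lt_right hτ (Real.one_lt_exp_iff.2 (by positivity))
    · rw [h]; exact ENNReal.ofReal_lt_top
    · rw [mul_div_cancel_left₀ _ hτ.ne', Real.log_exp, mul_div_cancel₀ _ hb0.ne']; norm_num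
  · rw [ENNReal.toReal_ofReal hτ.le] at hb
    have hlt := (ENNReal.ofReal_lt_iff_lt_toReal hτ.le h).1 hρ
    have hlog : 0 < Real.log ((rho w).toReal / τ) := Real.log_pos ((one_lt_div hτ).2 hlt)
    rw [div_lt_iff₀ hlog] at hb
    have hc : Tendsto (fun r : ℝ => b * Real.log (r / τ)) (𝓝[<] (rho w).toReal)
        (𝓝 (b * Real.log ((rho w).toReal / τ))) := by
      refine Tendsto.mono_left ?_ nhdsWithin_le_nhds
      exact ((tendsto_id.div_const τ).log (div_pos (hτ.trans hlt) hτ).ne').const_mul _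
    obtain ⟨r, ⟨h1, h2⟩, h3⟩ := ((hc.eventually (lt_mem_nhds hb)).and
      (nhdsWithin_le_nhds (lt_mem_nhds hlt))).and
      (self_mem_nhdsWithin : Set.Iio (rho w).toReal ∈ 𝓝[<] (rho w).toReal) |>.exists
    exact ⟨r, h2, (ENNReal.ofReal_lt_iff_lt_toReal (hτ.trans h2).le h).2 h3, h1⟩

end BallsInBoxes

/-! ### Assembly of the theorem from the two tail estimates -/

open BallsInBoxes

theorem mainTheorem9 (w : ℕ → ℝ≥0) (hw0 : 0 < w 0) (hw : ∃ k, 1 ≤ k ∧ 0 < w k)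
    (m n : ℕ → ℕ) (lam : ℝ)
    (hn : Filter.Tendsto n Filter.atTop Filter.atTop)
    (hmn : Filter.Tendsto (fun i => (m i : ℝ) / (n i : ℝ)) Filter.atTop (𝓝 lam))
    (hZ : ∀ i, 0 < BallsInBoxes.partitionFun w (m i) (n i))
    (hlam : 0 < lam) (hnu : ENNReal.ofReal lam < BallsInBoxes.nu w) :
    ∃ τ : ℝ≥0∞,
      (0 < τ ∧ τ < BallsInBoxes.rho w ∧ BallsInBoxes.Psi w τ = ENNReal.ofReal lam ∧
        ∀ s ≤ BallsInBoxes.rho w, BallsInBoxes.Psi w s = ENNReal.ofReal lam → s = τ) ∧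
      (∃ X : ∀ i, (Fin (n i) → ℕ) → ℝ,
        BallsInBoxes.IsLittleOp (fun i => BallsInBoxes.allocLaw w (m i) (n i)) X
          (fun i => Real.log (n i)) ∧
        ∀ i y, (BallsInBoxes.nthLargest y 1 : ℝ) ≤
          BallsInBoxes.invLogRatio (BallsInBoxes.rho w) τ * Real.log (n i) + X i y) ∧
      (BallsInBoxes.rho w = ⊤ →
        BallsInBoxes.IsLittleOp (fun i => BallsInBoxes.allocLaw w (m i) (n i))
          (fun _ y => (BallsInBoxes.nthLargest y 1 : ℝ)) (fun i => Real.log (n i))) ∧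
      (Filter.Tendsto (fun k : ℕ => (w k : ℝ≥0∞) ^ (1 / (k : ℝ))) Filter.atTop
          (𝓝 (BallsInBoxes.rho w)⁻¹) →
        ∀ j : ℕ, 1 ≤ j →
          BallsInBoxes.TendstoInProb (fun i => BallsInBoxes.allocLaw w (m i) (n i))
            (fun i y => (BallsInBoxes.nthLargest y j : ℝ) / Real.log (n i))
            (BallsInBoxes.invLogRatio (BallsInBoxes.rho w) τ)) := by
  obtain ⟨τ, hτ, hτρ, hτlam, ⟨R, hR, hRρ⟩, huniq⟩ := exists_tau hw0 hw hlam hnu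
  rw [← hτlam] at hmn
  obtain ⟨T, hTx, hT⟩ := exists_tendsto_tau hw0 hw hτ hR hRρ hmn
  obtain ⟨C, hC, hbd⟩ := exists_allocLaw_le hw0 hw hτ hR hRρ hT hn hZ hTx hmn
  set c := invLogRatio (rho w) (ENNReal.ofReal τ) with hc
  have hc0 : 0 ≤ c := invLogRatio_nonneg hτ hτρ
  have hlog : ∀ᶠ i in atTop, 0 < Real.log (n i) :=
    (hn.eventually_ge_atTop 2).mono fun i hi => Real.log_pos (by exact_mod_cast hi)
  have hupper : ∀ b, c < b → Tendsto
      (fun i => allocLaw w (m i) (n i) {y | b * Real.log (n i) ≤ nthLargest y 1}) atTop (𝓝 0) := by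
    intro b hb
    obtain ⟨r, hr, hrρ, h1⟩ := exists_one_lt_mul_log hτ hτρ hb
    exact tendsto_measure_le_first hw0 hτ hr hrρ hT hn hC hbd (hc0.trans_lt hb) h1
  refine ⟨ENNReal.ofReal τ, ⟨ENNReal.ofReal_pos.2 hτ, hτρ, ?_, huniq⟩,
    -- The error term is the positive part of the excess over `c log n`.
    ⟨fun i y => max ((nthLargest y 1 : ℝ) - c * Real.log (n i)) 0, ?_, fun i y => ?_⟩, ?_, ?_⟩
  · rw [Psi_ofReal hw0 hτ.le hτρ, hτlam]
  · intro ε hε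
    refine tendsto_of_tendsto_of_tendsto_of_le_of_le' tendsto_const_nhds
      (hupper (c + ε) (by linarith)) (Eventually.of_forall fun _ => zero_le) ?_
    filter_upwards [hlog] with i hi
    refine measure_mono fun y hy => ?_
    simp only [Set.mem_ofPred_eq, sub_zero] at hy ⊢
    rw [abs_of_nonneg (div_nonneg (le_max_right _ _) hi.le), le_div_iff₀ hi, le_max_iff] at hy
    rcases hy with hy | hy
    · linarith
    · exact absurd hy (not_le.2 (mul_pos hε hi))
  · have := le_max_left ((nthLargest y 1 : ℝ) - c * Real.log (n i)) 0
    linarith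
  · intro htop ε hε
    have hc' : c = 0 := by rw [hc, invLogRatio, if_pos htop]
    refine tendsto_of_tendsto_of_tendsto_of_le_of_le' tendsto_const_nhds
      (hupper ε (by rwa [hc'])) (Eventually.of_forall fun _ => zero_le) ?_
    filter_upwards [hlog] with i hi
    refine measure_mono fun y hy => ?_
    simp only [Set.mem_ofPred_eq, sub_zero] at hy ⊢
    rwa [abs_of_nonneg (div_nonneg (Nat.cast_nonneg _) hi.le), le_div_iff₀ hi] at hy
  · intro hlim j hj ε hε
    have hlower : Tendsto (fun i => allocLaw w (m i) (n i)
        {y | (nthLargest y j : ℝ) ≤ (c - ε) * Real.log (n i)}) atTop (𝓝 0) := by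
      -- When `c = 0`, the event would make a nonnegative number at most `-ε log n < 0`; no lower
      -- estimate is needed.
      rcases hc0.eq_or_lt with hc1 | hc1
      · refine tendsto_const_nhds.congr' ?_
        filter_upwards [hlog] with i hi
        rw [← hc1, zero_sub, Set.eq_empty_of_forall_notMem (s := {y | _}), measure_empty]
        intro y hy
        have hy' : (nthLargest y j : ℝ) ≤ -ε * Real.log (n i) := hy
        have := mul_pos hε hi
        have : (0 : ℝ) ≤ nthLargest y j := Nat.cast_nonneg _
        linarith
      · have htop : rho w ≠ ⊤ := fun h => hc1.ne' (by rw [hc, invLogRatio, if_pos h])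
        have hce : c = 1 / Real.log ((rho w).toReal / τ) := by
          rw [hc, invLogRatio, if_neg htop, ENNReal.toReal_ofReal hτ.le]
        have hlogpos : 0 < Real.log ((rho w).toReal / τ) := by
          rw [hce] at hc1; exact one_div_pos.1 hc1
        -- `c - ε` may be negative, while the lower tail estimate needs a positive `b`; enlarging it
        -- to at least `c/2` keeps it below `c`.
        have hb0 : 0 < max (c - ε) (c / 2) := (half_pos hc1).trans_le (le_max_right _ _)
        have hb1 : max (c - ε) (c / 2) < c := max_lt (by linarith) (half_lt_self hc1)
        have hb2 : max (c - ε) (c / 2) * Real.log ((rho w).toReal / τ) < 1 := by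
          have h := hb1
          nth_rewrite 3 [hce] at h
          exact (lt_div_iff₀ hlogpos).1 h
        refine tendsto_of_tendsto_of_tendsto_of_le_of_le' tendsto_const_nhds
          (tendsto_measure_nthLargest_le hw0 hτ hR hRρ hT hn hC hbd htop hlim hb0 hb2 hj)
          (Eventually.of_forall fun _ => zero_le) ?_
        filter_upwards [hlog] with i hi
        refine measure_mono fun y hy => ?_
        have hy' : (nthLargest y j : ℝ) ≤ (c - ε) * Real.log (n i) := hy
        exact hy'.trans (mul_le_mul_of_nonneg_right (le_max_left _ _) hi.le)
    have hsum := (hupper (c + ε) (by linarith)).add hlower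
    rw [add_zero] at hsum
    refine tendsto_of_tendsto_of_tendsto_of_le_of_le' tendsto_const_nhds hsum
      (Eventually.of_forall fun _ => zero_le) ?_
    filter_upwards [hlog] with i hi
    refine (measure_mono fun y hy => ?_).trans (measure_union_le _ _)
    have hy' : ε ≤ |(nthLargest y j : ℝ) / Real.log (n i) - c| := hy
    have hmono : (nthLargest y j : ℝ) ≤ nthLargest y 1 := by
      exact_mod_cast nthLargest_le_first y j
    -- A large `Y_(j)` forces a large `Y_(1)`, so the upper deviation needs no estimate specific to
    -- `j`.
    rcases le_abs.1 hy' with h | h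
    · left
      have h1 : c + ε ≤ (nthLargest y j : ℝ) / Real.log (n i) := by linarith
      rw [le_div_iff₀ hi] at h1
      exact h1.trans hmono
    · right
      have h1 : (nthLargest y j : ℝ) / Real.log (n i) ≤ c - ε := by linarith
      rwa [div_le_iff₀ hi] at h1
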